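/- A fusion category is a $\mathbb{C}$-linear semisimple (abelian) rigid monoidal category $\mathcal{C}$ with bilinear tensor product, finitely many isomorphism classes of simple objects, finite-dimensional morphism spaces and $\mathrm{End}(\mathbf 1)\cong\mathbb{C}$; it is skeletal if isomorphic objects are equal. The strictification of a skeletal fusion category $\mathcal{C}$ is the strict monoidal category $\mathcal{C}^{\mathrm{str}}$ whose objects are the finite sequences $(x_1,\dots,x_n)$ of simple objects of $\mathcal{C}$ ("strands"), whose morphisms $(x_1,\dots,x_m)\to(y_1,\dots,y_n)$ are the morphisms $x_1\otimes\cdots\otimes x_m\to y_1\otimes\cdots\otimes y_n$ of $\mathcal{C}$ (for a fixed bracketing), and whose tensor product is concatenation, with the empty sequence as unit. A choice of rigidity structures on $\mathcal{C}^{\mathrm{str}}$ consists of an involution $x\mapsto x^*$ on strands and, for every strand $x$, of morphisms $b_x:\mathbf 1\to x\otimes x^*$ and $d_x:x^*\otimes x\to\mathbf 1$ satisfying the two rigidity (zig-zag) equations; it extends to all sequences by $(x_1,\dots,x_n)^*=(x_n^*,\dots,x_1^*)$ with nested $b$'s and $d$'s, and so determines the double dual functor $**$ and the quadruple dual functor $****$.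 For an endomorphism $f$ of a strand $z$, the right pseudo-trace $\mathrm{ptr}_r(f)\in\mathrm{End}(\mathbf 1)$ is the composite of first $b_z$, then $f\otimes \mathrm{id}_{z^*}$, then $d_{z^*}$, and the left pseudo-trace $\mathrm{ptr}_l(f)$ is the composite of first $b_{z^*}$, then $\mathrm{id}_{z^*}\otimes f$, then $d_z$ (using $z^{**}=z$). Theorem. (1) Let $\mathcal{C}$ be a skeletal fusion category. Then $\mathcal{C}^{\mathrm{str}}$ has a choice of rigidity structures. For every such choice there are nonzero scalars $c_x$, one for each strand $x$, such that after replacing $b_x$ by $c_x b_x$ and $d_x$ by $c_x^{-1}d_x$ the left and right pseudo-traces agree on all endomorphisms of all strands. For every choice of rigidity structures for which the left and right pseudo-traces agree, the quadruple dual functor of $\mathcal{C}^{\mathrm{str}}$ is equal to the identity functor, on objects and on morphisms, and this identification is monoidal. (2) Let $\mathcal{C}$ be any fusion category, with any choice of (right) duals of its objects. Then the quadruple dual functor of $\mathcal{C}$ is isomorphic to the identity functor by a monoidal natural isomorphism. -/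

import Mathlib

open CategoryTheory MonoidalCategory Limits

universe v u

/-! ## Fusion categories -/

section FusionCategory

attribute [local instance] Abelian.hasFiniteBiproducts

/-- A fusion category over `ℂ`: an abelian `ℂ`-linear monoidal category with bilinear tensor
product that is semisimple (every object is a finite direct sum of simple objects), rigid (every
object has a left and a right dual), has finitely many simple objects up to isomorphism, finite
dimensional morphism spaces, and one dimensional `End 𝟙`. -/
class IsFusionCategory (C : Type u) [Category.{v} C] [Abelian C] [Linear ℂ C]
    [MonoidalCategory C] : Prop where
  monoidalPreadditive : MonoidalPreadditive C
  monoidalLinear : MonoidalLinear ℂ C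
  semisimple : ∀ X : C, ∃ (n : ℕ) (s : Fin n → C),
    (∀ i, Simple (s i)) ∧ Nonempty (X ≅ ⨁ s)
  rightRigid : ∀ X : C, Nonempty (HasRightDual X)
  leftRigid : ∀ X : C, Nonempty (HasLeftDual X)
  finite_simples : ∃ (n : ℕ) (s : Fin n → C), ∀ X : C, Simple X → ∃ i, Nonempty (X ≅ s i)
  finite_hom : ∀ X Y : C, Module.Finite ℂ (X ⟶ Y)
  finrank_end_unit : Module.finrank ℂ (𝟙_ C ⟶ 𝟙_ C) = 1

attribute [instance] IsFusionCategory.monoidalPreadditive IsFusionCategory.monoidalLinear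

end FusionCategory

/-! ## The double dual functor of a monoidal category with chosen duals -/

section DoubleDual

variable (C : Type u) [Category.{v} C] [MonoidalCategory C] [RightRigidCategory C]

/-- The double dual functor `**`. -/
noncomputable def doubleDual : C ⥤ C where
  obj X := (Xᘁ)ᘁ
  map f := (fᘁ)ᘁ
  map_id X := by simp
  map_comp f g := by rw [comp_rightAdjointMate, comp_rightAdjointMate]

/-- The quadruple dual functor `****`. -/
noncomputable def quadrupleDual : C ⥤ C := doubleDual C ⋙ doubleDual C

variable {C}

/-- The isomorphism `X* ≅ Y*` dual to the inverse of `i : X ≅ Y`. -/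
noncomputable def dualIso {X Y : C} (i : X ≅ Y) : Xᘁ ≅ Yᘁ where
  hom := (i.inv)ᘁ
  inv := (i.hom)ᘁ
  hom_inv_id := by rw [← comp_rightAdjointMate, i.hom_inv_id, rightAdjointMate_id]
  inv_hom_id := by rw [← comp_rightAdjointMate, i.inv_hom_id, rightAdjointMate_id]

/-- The canonical isomorphism `(X ⊗ Y)** ≅ X** ⊗ Y**`, induced twice by `(A ⊗ B)* ≅ B* ⊗ A*`. -/
noncomputable def doubleDualTensor (X Y : C) :
    (doubleDual C).obj (X ⊗ Y) ≅ (doubleDual C).obj X ⊗ (doubleDual C).obj Y :=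
  dualIso (rightDualTensorIso X Y) ≪≫ rightDualTensorIso (Yᘁ) (Xᘁ)

/-- The canonical isomorphism `𝟙* ≅ 𝟙`, where `𝟙*` is the chosen dual of `𝟙`. -/
noncomputable def dualUnit :
    (RightRigidCategory.rightDual (𝟙_ C)).rightDual ≅ 𝟙_ C :=
  rightDualIso (RightRigidCategory.rightDual (𝟙_ C)).exact exactPairingUnit

variable (C) in
/-- The canonical isomorphism `𝟙** ≅ 𝟙`, induced twice by `𝟙* ≅ 𝟙`. -/
noncomputable def doubleDualUnit : (doubleDual C).obj (𝟙_ C) ≅ 𝟙_ C :=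
  dualIso dualUnit ≪≫ dualUnit

/-- The canonical isomorphism `(X ⊗ Y)**** ≅ X**** ⊗ Y****`. -/
noncomputable def quadrupleDualTensor (X Y : C) :
    (quadrupleDual C).obj (X ⊗ Y) ≅ (quadrupleDual C).obj X ⊗ (quadrupleDual C).obj Y :=
  (doubleDual C).mapIso (doubleDualTensor X Y) ≪≫
    doubleDualTensor ((doubleDual C).obj X) ((doubleDual C).obj Y)

variable (C) in
/-- The canonical isomorphism `𝟙**** ≅ 𝟙`. -/
noncomputable def quadrupleDualUnit : (quadrupleDual C).obj (𝟙_ C) ≅ 𝟙_ C :=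
  (doubleDual C).mapIso (doubleDualUnit C) ≪≫ doubleDualUnit C

/-- A natural isomorphism `**** ≅ Id` is monoidal if it is compatible with the canonical monoidal
structure of the quadruple dual functor. -/
def IsMonoidalQuadrupleDualIso (e : quadrupleDual C ≅ 𝟭 C) : Prop :=
  (∀ X Y : C, e.hom.app (X ⊗ Y) =
    (quadrupleDualTensor X Y).hom ≫ (e.hom.app X ⊗ₘ e.hom.app Y)) ∧
  e.hom.app (𝟙_ C) = (quadrupleDualUnit C).hom

end DoubleDual

/-! ## Strictification on sequences of simple objects -/

section Strictification

variable (C : Type u) [Category.{v} C] [Abelian C] [MonoidalCategory C]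

/-- A strand is a simple object. -/
def Strand : Type u := {X : C // Simple X}

variable {C}

/-- The tensor product in `C` of a finite sequence of strands, `x₁ ⊗ (x₂ ⊗ (⋯ ⊗ 𝟙))`. -/
def tensorList : List (Strand C) → C
  | [] => 𝟙_ C
  | x :: L => x.1 ⊗ tensorList L

variable (C) in
/-- The strictification of `C`: objects are finite sequences of strands, and morphisms
`(x₁, …, xₘ) ⟶ (y₁, …, yₙ)` are the morphisms `x₁ ⊗ ⋯ ⊗ xₘ ⟶ y₁ ⊗ ⋯ ⊗ yₙ` of `C`. -/
abbrev Strictification : Type u := InducedCategory C (tensorList (C := C))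

namespace Strictification

/-- The functor sending a sequence to its tensor product. -/
abbrev toBase : Strictification C ⥤ C := inducedFunctor tensorList

/-- The canonical comparison, composed of associators and a left unitor, between the tensor
product of two sequences and the tensor product of their concatenation. -/
def appendIso : ∀ L M : List (Strand C), tensorList L ⊗ tensorList M ≅ tensorList (L ++ M)
  | [], M => λ_ (tensorList M)
  | x :: L, M => α_ x.1 (tensorList L) (tensorList M) ≪≫ whiskerLeftIso x.1 (appendIso L M)

/-- The tensor product is concatenation of sequences, the unit is the empty sequence, and
associators and unitors are identities. -/
instance : MonoidalCategoryStruct (Strictification C) where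
  tensorObj L M := List.append L M
  tensorUnit := ([] : List (Strand C))
  tensorHom {L L' M M'} f g :=
    InducedCategory.homMk ((appendIso L M).inv ≫ (f.hom ⊗ₘ g.hom) ≫ (appendIso L' M').hom)
  whiskerLeft L {M M'} f :=
    InducedCategory.homMk ((appendIso L M).inv ≫ (tensorList L ◁ f.hom) ≫ (appendIso L M').hom)
  whiskerRight {L L'} f M :=
    InducedCategory.homMk ((appendIso L M).inv ≫ (f.hom ▷ tensorList M) ≫ (appendIso L' M).hom)
  associator L M N := eqToIso (List.append_assoc L M N)
  leftUnitor L := eqToIso (List.nil_append L)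
  rightUnitor L := eqToIso (List.append_nil L)

theorem eqToHom_hom {L M : Strictification C} (h : L = M) :
    (eqToHom h).hom = eqToHom (congrArg tensorList h) := by
  subst h; rfl

theorem whiskerLeft_eqToHom_tensorList (x : Strand C) {L M : List (Strand C)} (h : L = M) :
    x.1 ◁ eqToHom (congrArg tensorList h) =
      eqToHom (congrArg tensorList (congrArg (List.cons x) h)) := by
  subst h
  exact MonoidalCategory.whiskerLeft_id _ _

theorem appendIso_assoc : ∀ L M N : List (Strand C),
    eqToHom (congrArg tensorList (List.append_assoc L M N)) =
      (appendIso (L ++ M) N).inv ≫ ((appendIso L M).inv ▷ tensorList N) ≫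
        (α_ (tensorList L) (tensorList M) (tensorList N)).hom ≫
          (tensorList L ◁ (appendIso M N).hom) ≫ (appendIso L (M ++ N)).hom
  | [], M, N => by
    simp [appendIso, tensorList]
  | x :: L, M, N => by
    have h := congrArg (fun f => x.1 ◁ f) (appendIso_assoc L M N)
    refine ((whiskerLeft_eqToHom_tensorList x (List.append_assoc L M N)).symm.trans h).trans ?_
    simp [appendIso, tensorList]

theorem appendIso_nil : ∀ L : List (Strand C),
    eqToHom (congrArg tensorList (List.append_nil L)) =
      (appendIso L []).inv ≫ (ρ_ (tensorList L)).hom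
  | [] => by
    have h : eqToHom (congrArg tensorList (List.append_nil ([] : List (Strand C)))) =
        𝟙 (𝟙_ C) := rfl
    refine h.trans ?_
    change _ = (λ_ (𝟙_ C)).inv ≫ (ρ_ (𝟙_ C)).hom
    rw [← unitors_equal, Iso.inv_hom_id]
  | x :: L => by
    have h := congrArg (fun f => x.1 ◁ f) (appendIso_nil L)
    refine ((whiskerLeft_eqToHom_tensorList x (List.append_nil L)).symm.trans h).trans ?_
    change _ = ((x.1 ◁ (appendIso L []).inv) ≫ (α_ x.1 (tensorList L) (𝟙_ C)).inv) ≫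
      (ρ_ (x.1 ⊗ tensorList L)).hom
    simp [tensorList]

/-- The comparison isomorphisms carry the structure of `Strictification C` to that of `C`. -/
def inducingData : Monoidal.InducingFunctorData (toBase (C := C)) where
  μIso L M := appendIso L M
  εIso := Iso.refl _
  whiskerLeft_eq _ _ _ _ := rfl
  whiskerRight_eq _ _ := rfl
  tensorHom_eq _ _ := rfl
  associator_eq L M N := by
    refine (eqToHom_hom (List.append_assoc L M N)).trans ((appendIso_assoc L M N).trans ?_)
    simp
    rfl
  leftUnitor_eq L := by
    refine (eqToHom_hom (List.nil_append L)).trans ?_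
    change 𝟙 (tensorList L) =
      ((λ_ (tensorList L)).inv ≫ (𝟙 (𝟙_ C) ⊗ₘ 𝟙 (tensorList L))) ≫ (λ_ (tensorList L)).hom
    simp
  rightUnitor_eq L := by
    refine (eqToHom_hom (List.append_nil L)).trans ((appendIso_nil L).trans ?_)
    have h : (ρ_ (tensorList L)).hom =
        (𝟙 (tensorList L) ⊗ₘ 𝟙 (𝟙_ C)) ≫ (ρ_ (tensorList L)).hom := by simp
    exact (congrArg (fun t => (appendIso L []).inv ≫ t) h).trans (Category.assoc _ _ _).symm

instance : MonoidalCategory (Strictification C) := Monoidal.induced toBase inducingData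

instance : (toBase (C := C)).Monoidal := Monoidal.fromInducedMonoidal toBase inducingData

instance : (toBase (C := C)).Additive where

instance [MonoidalPreadditive C] : MonoidalPreadditive (Strictification C) :=
  monoidalPreadditive_of_faithful toBase

instance [Linear ℂ C] : (toBase (C := C)).Linear ℂ where

instance [Linear ℂ C] [MonoidalPreadditive C] [MonoidalLinear ℂ C] :
    MonoidalLinear ℂ (Strictification C) :=
  MonoidalLinear.ofFaithful ℂ toBase

/-- The sequence of length one consisting of the strand `x`. -/
def single (x : Strand C) : Strictification C := [x]

end Strictification

end Strictification

/-! ## Rigidity structures on the strictification -/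

section Rigidity

open Strictification

variable (C : Type u) [Category.{v} C] [Abelian C] [MonoidalCategory C]

/-- A choice of rigidity structures: an involution `x ↦ x*` on strands, and for every strand a
birth `b_x : 𝟙 ⟶ x ⊗ x*` and a death `d_x : x* ⊗ x ⟶ 𝟙` satisfying the rigidity equations. -/
structure RigidityChoice where
  /-- The dual strand. -/
  dual : Strand C → Strand C
  dual_dual : ∀ x, dual (dual x) = x
  /-- The birth and the death of a strand. -/
  pairing : ∀ x, ExactPairing (single x) (single (dual x))

namespace RigidityChoice

variable {C} (R : RigidityChoice C)

/-- The birth `b_x : 𝟙 ⟶ x ⊗ x*`. -/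
def birth (x : Strand C) : 𝟙_ (Strictification C) ⟶ single x ⊗ single (R.dual x) :=
  (R.pairing x).coevaluation'

/-- The death `d_x : x* ⊗ x ⟶ 𝟙`. -/
def death (x : Strand C) : single (R.dual x) ⊗ single x ⟶ 𝟙_ (Strictification C) :=
  (R.pairing x).evaluation'

/-- The dual `(xₙ*, …, x₁*)` of the sequence `(x₁, …, xₙ)`. -/
def dualList : Strictification C → Strictification C
  | [] => 𝟙_ (Strictification C)
  | x :: L => dualList L ⊗ single (R.dual x)

/-- Nested births and deaths exhibit `(xₙ*, …, x₁*)` as a dual of `(x₁, …, xₙ)`. -/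
@[reducible]
def pairingList : ∀ L : Strictification C, ExactPairing L (R.dualList L)
  | [] => exactPairingUnit
  | x :: L =>
    @ExactPairing.tensor _ _ _ (single x) L (single (R.dual x)) (R.dualList L)
      (R.pairing x) (pairingList L)

/-- The rigidity structure on all sequences determined by the one on strands. -/
@[reducible]
def rightRigid : RightRigidCategory (Strictification C) where
  rightDual L := @HasRightDual.mk _ _ _ L (R.dualList L) (R.pairingList L)

/-- The quadruple dual functor of the strictification with respect to the chosen rigidity. -/
noncomputable def quadDual : Strictification C ⥤ Strictification C :=
  @quadrupleDual (Strictification C) _ _ R.rightRigid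

/-- The identity morphism from `x` to `x** = x`. -/
def toDoubleDual (x : Strand C) : single x ⟶ single (R.dual (R.dual x)) :=
  eqToHom (congrArg single (R.dual_dual x).symm)

/-- The right pseudo-trace of `f : z ⟶ z`: the birth `b_z`, then `f ⊗ id`, then the death `d_{z*}`,
as an element of `End 𝟙`. -/
def ptrRight (z : Strand C) (f : single z ⟶ single z) :
    𝟙_ (Strictification C) ⟶ 𝟙_ (Strictification C) :=
  R.birth z ≫ (f ≫ R.toDoubleDual z) ▷ single (R.dual z) ≫ R.death (R.dual z)

/-- The left pseudo-trace of `f : z ⟶ z`: the birth `b_{z*}`, then `id ⊗ f`, then the death `d_z`,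
as an element of `End 𝟙`. -/
def ptrLeft (z : Strand C) (f : single z ⟶ single z) :
    𝟙_ (Strictification C) ⟶ 𝟙_ (Strictification C) :=
  R.birth (R.dual z) ≫
    single (R.dual z) ◁ (eqToHom (congrArg single (R.dual_dual z)) ≫ f) ≫ R.death z

/-- Left and right pseudo-traces agree on every strand. -/
def IsPseudoSpherical : Prop :=
  ∀ (z : Strand C) (f : single z ⟶ single z), R.ptrRight z f = R.ptrLeft z f

/-- Rescaling of the rigidity morphisms: `b_x` is multiplied by `c x` and `d_x` by `(c x)⁻¹`. -/
noncomputable def rescale [Linear ℂ C] [MonoidalPreadditive C] [MonoidalLinear ℂ C] (c : Strand C → ℂˣ) :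
    RigidityChoice C where
  dual := R.dual
  dual_dual := R.dual_dual
  pairing x :=
    { coevaluation' := (c x : ℂ) • R.birth x
      evaluation' := ((c x : ℂ)⁻¹) • R.death x
      coevaluation_evaluation' := by
        have h := (R.pairing x).coevaluation_evaluation'
        simpa [birth, death, smul_smul] using h
      evaluation_coevaluation' := by
        have h := (R.pairing x).evaluation_coevaluation'
        simpa [birth, death, smul_smul] using h }

end RigidityChoice

end Rigidity

section PairingTrace

open ExactPairing

variable {C : Type u} [Category.{v} C] [MonoidalCategory C]

/-- The right trace of a morphism from `X` to a double dual `Z` of `X`. -/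
def trRight {X : C} (Y : C) {Z : C} [ExactPairing X Y] [ExactPairing Y Z] (f : X ⟶ Z) :
    𝟙_ C ⟶ 𝟙_ C :=
  η_ X Y ≫ f ▷ Y ≫ ε_ Y Z

/-- The left trace of a morphism to `X` from a double dual `Z` of `X`. -/
def trLeft {X : C} (Y : C) {Z : C} [ExactPairing X Y] [ExactPairing Y Z] (g : Z ⟶ X) :
    𝟙_ C ⟶ 𝟙_ C :=
  η_ Y Z ≫ Y ◁ g ≫ ε_ X Y

/-- The right trace of an endomorphism followed by `φ` agrees with its left trace preceded by the
inverse of `φ`. -/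
def IsSpherical {X : C} (Y : C) {Z : C} [ExactPairing X Y] [ExactPairing Y Z] (φ : X ≅ Z) : Prop :=
  ∀ E : X ⟶ X, trRight Y (E ≫ φ.hom) = trLeft Y (φ.inv ≫ E)

/-- The partial right trace. -/
def ptRight {A B X : C} (Y : C) {Z : C} [ExactPairing X Y] [ExactPairing Y Z]
    (F : A ⊗ X ⟶ B ⊗ Z) : A ⟶ B :=
  𝟙 _ ⊗≫ A ◁ η_ X Y ⊗≫ F ▷ Y ⊗≫ B ◁ ε_ Y Z ⊗≫ 𝟙 _

/-- The partial left trace. -/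
def ptLeft {A B X : C} (Y : C) {Z : C} [ExactPairing X Y] [ExactPairing Y Z]
    (F : Z ⊗ A ⟶ X ⊗ B) : A ⟶ B :=
  𝟙 _ ⊗≫ η_ Y Z ▷ A ⊗≫ Y ◁ F ⊗≫ ε_ X Y ▷ B ⊗≫ 𝟙 _

section

variable {A A' B B' X : C} (Y : C) {Z : C} [ExactPairing X Y] [ExactPairing Y Z]

theorem ptRight_comp (F : A ⊗ X ⟶ B ⊗ Z) (b : B ⟶ B') :
    ptRight Y (F ≫ b ▷ Z) = ptRight Y F ≫ b := by
  calc _ = 𝟙 _ ⊗≫ A ◁ η_ X Y ⊗≫ F ▷ Y ⊗≫ (b ▷ (Z ⊗ Y) ≫ B' ◁ ε_ Y Z) ⊗≫ 𝟙 _ := by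
        dsimp only [ptRight]; monoidal
    _ = 𝟙 _ ⊗≫ A ◁ η_ X Y ⊗≫ F ▷ Y ⊗≫ (B ◁ ε_ Y Z ≫ b ▷ 𝟙_ C) ⊗≫ 𝟙 _ := by
        rw [whisker_exchange]
    _ = _ := by dsimp only [ptRight]; monoidal

theorem comp_ptRight (a : A' ⟶ A) (F : A ⊗ X ⟶ B ⊗ Z) :
    ptRight Y (a ▷ X ≫ F) = a ≫ ptRight Y F := by
  calc _ = 𝟙 _ ⊗≫ (A' ◁ η_ X Y ≫ a ▷ (X ⊗ Y)) ⊗≫ F ▷ Y ⊗≫ B ◁ ε_ Y Z ⊗≫ 𝟙 _ := by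
        dsimp only [ptRight]; monoidal
    _ = 𝟙 _ ⊗≫ (a ▷ 𝟙_ C ≫ A ◁ η_ X Y) ⊗≫ F ▷ Y ⊗≫ B ◁ ε_ Y Z ⊗≫ 𝟙 _ := by
        rw [whisker_exchange]
    _ = _ := by dsimp only [ptRight]; monoidal

theorem ptLeft_comp (F : Z ⊗ A ⟶ X ⊗ B) (b : B ⟶ B') :
    ptLeft Y (F ≫ X ◁ b) = ptLeft Y F ≫ b := by
  calc _ = 𝟙 _ ⊗≫ η_ Y Z ▷ A ⊗≫ Y ◁ F ⊗≫ ((Y ⊗ X) ◁ b ≫ ε_ X Y ▷ B') ⊗≫ 𝟙 _ := by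
        dsimp only [ptLeft]; monoidal
    _ = 𝟙 _ ⊗≫ η_ Y Z ▷ A ⊗≫ Y ◁ F ⊗≫ (ε_ X Y ▷ B ≫ 𝟙_ C ◁ b) ⊗≫ 𝟙 _ := by
        rw [whisker_exchange]
    _ = _ := by dsimp only [ptLeft]; monoidal

theorem comp_ptLeft (a : A' ⟶ A) (F : Z ⊗ A ⟶ X ⊗ B) :
    ptLeft Y (Z ◁ a ≫ F) = a ≫ ptLeft Y F := by
  calc _ = 𝟙 _ ⊗≫ (η_ Y Z ▷ A' ≫ (Y ⊗ Z) ◁ a) ⊗≫ Y ◁ F ⊗≫ ε_ X Y ▷ B ⊗≫ 𝟙 _ := by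
        dsimp only [ptLeft]; monoidal
    _ = 𝟙 _ ⊗≫ (𝟙_ C ◁ a ≫ η_ Y Z ▷ A) ⊗≫ Y ◁ F ⊗≫ ε_ X Y ▷ B ⊗≫ 𝟙 _ := by
        rw [whisker_exchange]
    _ = _ := by dsimp only [ptLeft]; monoidal

end

section

variable {X₁ Y₁ Z₁ X₂ Y₂ Z₂ : C} [ExactPairing X₁ Y₁] [ExactPairing Y₁ Z₁]
  [ExactPairing X₂ Y₂] [ExactPairing Y₂ Z₂]

theorem trRight_tensor (F : X₁ ⊗ X₂ ⟶ Z₁ ⊗ Z₂) :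
    trRight (Y₂ ⊗ Y₁) F = trRight Y₁ (ptRight Y₂ F) := by
  dsimp only [trRight, ptRight]
  rw [tensor_coevaluation, tensor_evaluation]
  monoidal

theorem trLeft_tensor (F : Z₁ ⊗ Z₂ ⟶ X₁ ⊗ X₂) :
    trLeft (Y₂ ⊗ Y₁) F = trLeft Y₂ (ptLeft Y₁ F) := by
  dsimp only [trLeft, ptLeft]
  rw [tensor_coevaluation, tensor_evaluation]
  monoidal

theorem trLeft_ptRight (F : Z₁ ⊗ X₂ ⟶ X₁ ⊗ Z₂) :
    trLeft Y₁ (ptRight Y₂ F) = trRight Y₂ (ptLeft Y₁ F) := by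
  calc _ = 𝟙 _ ⊗≫ (η_ Y₁ Z₁ ▷ 𝟙_ C ≫ (Y₁ ⊗ Z₁) ◁ η_ X₂ Y₂) ⊗≫ Y₁ ◁ F ▷ Y₂ ⊗≫
          ((Y₁ ⊗ X₁) ◁ ε_ Y₂ Z₂ ≫ ε_ X₁ Y₁ ▷ 𝟙_ C) ⊗≫ 𝟙 _ := by
        dsimp only [trLeft, ptRight]; monoidal
    _ = 𝟙 _ ⊗≫ (𝟙_ C ◁ η_ X₂ Y₂ ≫ η_ Y₁ Z₁ ▷ (X₂ ⊗ Y₂)) ⊗≫ Y₁ ◁ F ▷ Y₂ ⊗≫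
          (ε_ X₁ Y₁ ▷ (Z₂ ⊗ Y₂) ≫ 𝟙_ C ◁ ε_ Y₂ Z₂) ⊗≫ 𝟙 _ := by
        rw [whisker_exchange, whisker_exchange]
    _ = _ := by dsimp only [trRight, ptLeft]; monoidal

theorem IsSpherical.tensor {φ₁ : X₁ ≅ Z₁} {φ₂ : X₂ ≅ Z₂} (h₁ : IsSpherical Y₁ φ₁)
    (h₂ : IsSpherical Y₂ φ₂) : IsSpherical (Y₂ ⊗ Y₁) (φ₁ ⊗ᵢ φ₂) := by
  intro E
  have e₁ : E ≫ (φ₁ ⊗ᵢ φ₂).hom = (E ≫ X₁ ◁ φ₂.hom) ≫ φ₁.hom ▷ Z₂ := by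
    rw [Category.assoc, tensorIso_hom, tensorHom_def']
  have e₂ : (φ₁ ⊗ᵢ φ₂).inv ≫ E = Z₁ ◁ φ₂.inv ≫ φ₁.inv ▷ X₂ ≫ E := by
    rw [tensorIso_inv, tensorHom_def', Category.assoc]
  rw [e₁, e₂, trRight_tensor, trLeft_tensor, ptRight_comp, h₁, ← comp_ptRight, trLeft_ptRight,
    ← Category.assoc, ptLeft_comp, h₂, comp_ptLeft]

end

end PairingTrace

section DualComparison

open ExactPairing

variable {C : Type u} [Category.{v} C] [MonoidalCategory C]

theorem whiskerLeft_cancel_coevaluation {X Y W : C} [ExactPairing X Y] {g g' : Y ⟶ W}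
    (h : η_ X Y ≫ X ◁ g = η_ X Y ≫ X ◁ g') : g = g' := by
  have key : ∀ k : Y ⟶ W,
      k = 𝟙 _ ⊗≫ Y ◁ (η_ X Y ≫ X ◁ k) ⊗≫ ε_ X Y ▷ W ⊗≫ 𝟙 _ := fun k => by
    symm
    calc _ = 𝟙 _ ⊗≫ Y ◁ η_ X Y ⊗≫ ((Y ⊗ X) ◁ k ≫ ε_ X Y ▷ W) ⊗≫ 𝟙 _ := by monoidal
      _ = 𝟙 _ ⊗≫ (Y ◁ η_ X Y ⊗≫ ε_ X Y ▷ Y) ⊗≫ k ⊗≫ 𝟙 _ := by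
        rw [whisker_exchange]; monoidal
      _ = k := by rw [coevaluation_evaluation'']; monoidal
  rw [key g, key g', h]

section Mate

variable {X Y₁ Y₂ : C}

theorem coevaluation_comp_rightDualIso (p₁ : ExactPairing X Y₁) (p₂ : ExactPairing X Y₂) :
    p₁.coevaluation' ≫ X ◁ (rightDualIso p₁ p₂).hom = p₂.coevaluation' := by
  have h := @coevaluation_comp_rightAdjointMate C _ _ X X ⟨Y₂⟩ ⟨Y₁⟩ (𝟙 X)
  refine h.trans ?_
  rw [id_whiskerRight, Category.comp_id]
  rfl

theorem rightDualIso_comp_evaluation (p₁ : ExactPairing X Y₁) (p₂ : ExactPairing X Y₂) :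
    (rightDualIso p₁ p₂).hom ▷ X ≫ p₂.evaluation' = p₁.evaluation' := by
  have h := @rightAdjointMate_comp_evaluation C _ _ X X ⟨Y₂⟩ ⟨Y₁⟩ (𝟙 X)
  refine h.trans ?_
  rw [MonoidalCategory.whiskerLeft_id, Category.id_comp]
  rfl

theorem eq_rightDualIso_hom (p₁ : ExactPairing X Y₁) (p₂ : ExactPairing X Y₂) (g : Y₁ ⟶ Y₂)
    (h : p₁.coevaluation' ≫ X ◁ g = p₂.coevaluation') : g = (rightDualIso p₁ p₂).hom :=
  @whiskerLeft_cancel_coevaluation C _ _ X Y₁ Y₂ p₁ _ _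
    (h.trans (coevaluation_comp_rightDualIso p₁ p₂).symm)

/-- The mate of a morphism is natural in the choice of the duals. -/
theorem rightAdjointMate_comp_rightDualIso {X₁ X₂ Y₁ Y₂ Y₁' Y₂' : C} (f : X₁ ⟶ X₂)
    (p₁ : ExactPairing X₁ Y₁) (p₁' : ExactPairing X₁ Y₁')
    (p₂ : ExactPairing X₂ Y₂) (p₂' : ExactPairing X₂ Y₂') :
    @rightAdjointMate C _ _ X₁ X₂ ⟨Y₁⟩ ⟨Y₂⟩ f ≫ (rightDualIso p₁ p₁').hom =
      (rightDualIso p₂ p₂').hom ≫ @rightAdjointMate C _ _ X₁ X₂ ⟨Y₁'⟩ ⟨Y₂'⟩ f := by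
  have h₁ := @comp_rightAdjointMate C _ _ X₁ X₁ X₂ ⟨Y₁'⟩ ⟨Y₁⟩ ⟨Y₂⟩ (𝟙 X₁) f
  have h₂ := @comp_rightAdjointMate C _ _ X₁ X₂ X₂ ⟨Y₁'⟩ ⟨Y₂'⟩ ⟨Y₂⟩ f (𝟙 X₂)
  rw [Category.id_comp] at h₁
  rw [Category.comp_id] at h₂
  exact h₁.symm.trans h₂

end Mate

theorem trRight_congr {X Y Z Y' Z' : C} [ExactPairing X Y] [ExactPairing Y Z]
    [ExactPairing X Y'] [ExactPairing Y' Z'] (i : Y ⟶ Y') (c : Z ⟶ Z')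
    (hi : η_ X Y ≫ X ◁ i = η_ X Y') (hc : (c ⊗ₘ i) ≫ ε_ Y' Z' = ε_ Y Z) (f : X ⟶ Z) :
    trRight Y f = trRight Y' (f ≫ c) := by
  dsimp only [trRight]
  rw [← hi, ← hc, tensorHom_def', Category.assoc, Category.assoc, comp_whiskerRight,
    Category.assoc, whisker_exchange_assoc, whisker_exchange_assoc, whisker_exchange_assoc]

theorem trLeft_congr {X Y Z Y' Z' : C} [ExactPairing X Y] [ExactPairing Y Z]
    [ExactPairing X Y'] [ExactPairing Y' Z'] (i : Y ⟶ Y') (c : Z ⟶ Z')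
    (hi : i ▷ X ≫ ε_ X Y' = ε_ X Y) (hc : η_ Y Z ≫ (i ⊗ₘ c) = η_ Y' Z') (g : Z' ⟶ X) :
    trLeft Y (c ≫ g) = trLeft Y' g := by
  dsimp only [trLeft]
  rw [← hi, ← hc, tensorHom_def', Category.assoc, Category.assoc,
    MonoidalCategory.whiskerLeft_comp, Category.assoc, whisker_exchange_assoc]

theorem rightAdjointMate_tensor {X₁ X₂ W₁ W₂ : C} [HasRightDual X₁] [HasRightDual X₂]
    [HasRightDual W₁] [HasRightDual W₂] (f : X₁ ⟶ W₁) (g : X₂ ⟶ W₂) :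
    @rightAdjointMate C _ _ (X₁ ⊗ X₂) (W₁ ⊗ W₂) ⟨X₂ᘁ ⊗ X₁ᘁ⟩ ⟨W₂ᘁ ⊗ W₁ᘁ⟩ (f ⊗ₘ g) =
      gᘁ ⊗ₘ fᘁ := by
  refine whiskerLeft_cancel_coevaluation (X := W₁ ⊗ W₂) ?_
  refine (@coevaluation_comp_rightAdjointMate C _ _ (X₁ ⊗ X₂) (W₁ ⊗ W₂) ⟨X₂ᘁ ⊗ X₁ᘁ⟩
    ⟨W₂ᘁ ⊗ W₁ᘁ⟩ (f ⊗ₘ g)).trans ?_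
  change η_ (X₁ ⊗ X₂) (X₂ᘁ ⊗ X₁ᘁ) ≫ (f ⊗ₘ g) ▷ (X₂ᘁ ⊗ X₁ᘁ) =
    η_ (W₁ ⊗ W₂) (W₂ᘁ ⊗ W₁ᘁ) ≫ (W₁ ⊗ W₂) ◁ (gᘁ ⊗ₘ fᘁ)
  have h₁ := coevaluation_comp_rightAdjointMate f
  have h₂ := coevaluation_comp_rightAdjointMate g
  rw [tensor_coevaluation, tensor_coevaluation, tensorHom_def',
    MonoidalCategory.tensorHom_def]
  symm
  calc _ = η_ W₁ (W₁ᘁ) ⊗≫ (W₁ ◁ (η_ W₂ (W₂ᘁ) ≫ W₂ ◁ gᘁ)) ▷ (W₁ᘁ) ⊗≫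
          (W₁ ⊗ W₂ ⊗ X₂ᘁ) ◁ fᘁ ⊗≫ 𝟙 _ := by monoidal
    _ = η_ W₁ (W₁ᘁ) ⊗≫ (((W₁ ◁ η_ X₂ (X₂ᘁ)) ⊗≫ W₁ ◁ g ▷ (X₂ᘁ)) ▷ (W₁ᘁ) ≫
          (W₁ ⊗ (W₂ ⊗ X₂ᘁ)) ◁ fᘁ) ⊗≫ 𝟙 _ := by rw [h₂]; monoidal
    _ = η_ W₁ (W₁ᘁ) ⊗≫ (((W₁ ⊗ 𝟙_ C) ◁ fᘁ) ≫ ((W₁ ◁ η_ X₂ (X₂ᘁ)) ⊗≫ W₁ ◁ g ▷ (X₂ᘁ)) ▷ (X₁ᘁ))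
          ⊗≫ 𝟙 _ := by rw [whisker_exchange]
    _ = (η_ W₁ (W₁ᘁ) ≫ W₁ ◁ fᘁ) ⊗≫ ((W₁ ◁ η_ X₂ (X₂ᘁ)) ⊗≫ W₁ ◁ g ▷ (X₂ᘁ)) ▷ (X₁ᘁ)
          ⊗≫ 𝟙 _ := by monoidal
    _ = η_ X₁ (X₁ᘁ) ⊗≫ ((f ▷ (𝟙_ C) ≫ (W₁ ◁ η_ X₂ (X₂ᘁ))) ⊗≫ W₁ ◁ g ▷ (X₂ᘁ)) ▷ (X₁ᘁ)
          ⊗≫ 𝟙 _ := by rw [h₁]; monoidal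
    _ = η_ X₁ (X₁ᘁ) ⊗≫ (X₁ ◁ η_ X₂ (X₂ᘁ) ⊗≫ (f ▷ X₂ ≫ W₁ ◁ g) ▷ (X₂ᘁ)) ▷ (X₁ᘁ)
          ⊗≫ 𝟙 _ := by rw [← whisker_exchange]; monoidal
    _ = _ := by rw [← whisker_exchange]; monoidal

variable [RightRigidCategory C]

/-- The comparison of the chosen double dual of `X` with another double dual. -/
noncomputable def doubleDualComparison {X Y Z : C} (p : ExactPairing X Y) (q : ExactPairing Y Z) :
    (Xᘁ)ᘁ ≅ Z :=
  dualIso (rightDualIso (RightRigidCategory.rightDual X).exact p) ≪≫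
    rightDualIso (RightRigidCategory.rightDual Y).exact q

theorem coevaluation_comp_doubleDualComparison {X Y Z : C} (p : ExactPairing X Y)
    (q : ExactPairing Y Z) :
    η_ (Xᘁ) (Xᘁ)ᘁ ≫ ((rightDualIso (RightRigidCategory.rightDual X).exact p).hom ⊗ₘ
      (doubleDualComparison p q).hom) = q.coevaluation' := by
  set i := rightDualIso (RightRigidCategory.rightDual X).exact p
  have h := coevaluation_comp_rightAdjointMate i.inv
  rw [tensorHom_def']
  change _ ≫ _ ◁ ((i.inv)ᘁ ≫ (rightDualIso (RightRigidCategory.rightDual Y).exact q).hom) ≫ _ = _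
  rw [MonoidalCategory.whiskerLeft_comp, Category.assoc, reassoc_of% h, ← whisker_exchange_assoc,
    ← comp_whiskerRight, i.inv_hom_id, id_whiskerRight, Category.comp_id]
  exact coevaluation_comp_rightDualIso _ q

theorem doubleDualComparison_comp_evaluation {X Y Z : C} (p : ExactPairing X Y)
    (q : ExactPairing Y Z) :
    ((doubleDualComparison p q).hom ⊗ₘ (rightDualIso (RightRigidCategory.rightDual X).exact p).hom)
      ≫ q.evaluation' = ε_ (Xᘁ) (Xᘁ)ᘁ := by
  set i := rightDualIso (RightRigidCategory.rightDual X).exact p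
  have h := rightAdjointMate_comp_evaluation i.inv
  have h' := rightDualIso_comp_evaluation (RightRigidCategory.rightDual Y).exact q
  rw [tensorHom_def']
  change (_ ◁ i.hom ≫ ((i.inv)ᘁ ≫ (rightDualIso _ q).hom) ▷ _) ≫ _ = _
  rw [comp_whiskerRight, Category.assoc, Category.assoc, h']
  refine (congrArg (fun t => _ ◁ i.hom ≫ t) h).trans ?_
  rw [← MonoidalCategory.whiskerLeft_comp_assoc, i.hom_inv_id, MonoidalCategory.whiskerLeft_id,
    Category.id_comp]

theorem isSpherical_comparison_iff {X Y Z : C} [p : ExactPairing X Y] [q : ExactPairing Y Z]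
    (φ : X ≅ (Xᘁ)ᘁ) :
    IsSpherical (Xᘁ) φ ↔ IsSpherical Y (φ ≪≫ doubleDualComparison p q) := by
  refine forall_congr' fun E => ?_
  have h₁ := trRight_congr (rightDualIso (RightRigidCategory.rightDual X).exact p).hom
    (doubleDualComparison p q).hom
    (coevaluation_comp_rightDualIso (RightRigidCategory.rightDual X).exact p)
    (doubleDualComparison_comp_evaluation p q) (E ≫ φ.hom)
  have h₂ := trLeft_congr (rightDualIso (RightRigidCategory.rightDual X).exact p).hom
    (doubleDualComparison p q).hom
    (rightDualIso_comp_evaluation (RightRigidCategory.rightDual X).exact p)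
    (coevaluation_comp_doubleDualComparison p q)
    ((φ ≪≫ doubleDualComparison p q).inv ≫ E)
  rw [h₁, Category.assoc, ← h₂]
  simp

theorem trRight_rotate {X Y : C} (f : X ⟶ Y) (h : Y ⟶ (Xᘁ)ᘁ) :
    trRight (Xᘁ) (f ≫ h) = trRight (Yᘁ) (h ≫ (fᘁ)ᘁ) := by
  dsimp only [trRight]
  have h₁ := coevaluation_comp_rightAdjointMate f
  have h₂ := rightAdjointMate_comp_evaluation (fᘁ)
  rw [comp_whiskerRight, comp_whiskerRight, Category.assoc, Category.assoc, h₂,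
    ← reassoc_of% h₁, whisker_exchange_assoc]

theorem trLeft_rotate {X Y : C} (f : Y ⟶ X) (h : (Xᘁ)ᘁ ⟶ Y) :
    trLeft (Xᘁ) (h ≫ f) = trLeft (Yᘁ) ((fᘁ)ᘁ ≫ h) := by
  dsimp only [trLeft]
  have h₁ := coevaluation_comp_rightAdjointMate (fᘁ)
  have h₂ := rightAdjointMate_comp_evaluation f
  rw [MonoidalCategory.whiskerLeft_comp, MonoidalCategory.whiskerLeft_comp, Category.assoc,
    Category.assoc, ← h₂, reassoc_of% h₁, whisker_exchange_assoc]

theorem rightAdjointMate_comp_rightDualTensorIso {X₁ X₂ W₁ W₂ : C} (f : X₁ ⟶ W₁) (g : X₂ ⟶ W₂) :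
    (f ⊗ₘ g)ᘁ ≫ (rightDualTensorIso X₁ X₂).hom = (rightDualTensorIso W₁ W₂).hom ≫ (gᘁ ⊗ₘ fᘁ) :=
  (rightAdjointMate_comp_rightDualIso (f ⊗ₘ g) _ _ _ _).trans
    (congrArg (fun t => (rightDualTensorIso W₁ W₂).hom ≫ t) (rightAdjointMate_tensor f g))

/-- The comparison `(X ⊗ Y)** ≅ X** ⊗ Y**` is natural. -/
theorem doubleDualTensor_naturality {X₁ X₂ W₁ W₂ : C} (f : X₁ ⟶ W₁) (g : X₂ ⟶ W₂) :
    ((f ⊗ₘ g)ᘁ)ᘁ ≫ (doubleDualTensor W₁ W₂).hom =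
      (doubleDualTensor X₁ X₂).hom ≫ ((fᘁ)ᘁ ⊗ₘ (gᘁ)ᘁ) := by
  have h₁ : (rightDualTensorIso W₁ W₂).inv ≫ (f ⊗ₘ g)ᘁ =
      (gᘁ ⊗ₘ fᘁ) ≫ (rightDualTensorIso X₁ X₂).inv := by
    rw [Iso.inv_comp_eq, ← Category.assoc, ← rightAdjointMate_comp_rightDualTensorIso,
      Category.assoc, Iso.hom_inv_id, Category.comp_id]
  have h₂ := congrArg (fun t => rightAdjointMate t) h₁
  rw [comp_rightAdjointMate, comp_rightAdjointMate] at h₂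
  change ((f ⊗ₘ g)ᘁ)ᘁ ≫ ((rightDualTensorIso W₁ W₂).inv)ᘁ ≫ (rightDualTensorIso _ _).hom =
    (((rightDualTensorIso X₁ X₂).inv)ᘁ ≫ (rightDualTensorIso _ _).hom) ≫ ((fᘁ)ᘁ ⊗ₘ (gᘁ)ᘁ)
  rw [reassoc_of% h₂, rightAdjointMate_comp_rightDualTensorIso, Category.assoc]

end DualComparison

section SimpleFamily

variable {D : Type u} [Category.{v} D] [Preadditive D] [Linear ℂ D]

/-- A family of pairwise non-isomorphic objects with scalar endomorphisms through which all
identities factor. -/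
structure SimpleFamily {ι : Type*} (s : ι → D) : Prop where
  hom_eq_zero : ∀ {i j}, i ≠ j → ∀ f : s i ⟶ s j, f = 0
  end_eq_smul : ∀ {i} (f : s i ⟶ s i), ∃ c : ℂ, f = c • 𝟙 (s i)
  id_ne_zero : ∀ i, 𝟙 (s i) ≠ 0
  decomposition : ∀ X : D, ∃ (n : ℕ) (k : Fin n → ι) (f : ∀ a, X ⟶ s (k a))
    (g : ∀ a, s (k a) ⟶ X), ∑ a, f a ≫ g a = 𝟙 X

namespace SimpleFamily

variable {ι : Type*} {s : ι → D} (hs : SimpleFamily s)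
include hs

theorem exists_comp_eq_id {X Y : D} {h : X ⟶ Y} (hh : h ≠ 0) :
    ∃ (i : ι) (p : s i ⟶ X) (q : Y ⟶ s i), p ≫ h ≫ q = 𝟙 (s i) := by
  obtain ⟨n, k, f, g, hX⟩ := hs.decomposition X
  obtain ⟨m, l, f', g', hY⟩ := hs.decomposition Y
  by_contra! hc
  refine hh ?_
  have h₀ : ∀ a b, g a ≫ h ≫ f' b = 0 := fun a b => by
    by_contra hne
    by_cases hkl : k a = l b
    · have key : ∀ (i j : ι) (hij : i = j) (p : s i ⟶ X) (q : Y ⟶ s j), p ≫ h ≫ q = 0 := by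
        rintro i _ rfl p q
        obtain ⟨c, hc'⟩ := hs.end_eq_smul (p ≫ h ≫ q)
        by_cases hc0 : c = 0
        · rw [hc', hc0, zero_smul]
        · refine absurd ?_ (hc i (c⁻¹ • p) q)
          rw [Linear.smul_comp, hc', smul_smul, inv_mul_cancel₀ hc0, one_smul]
      exact hne (key _ _ hkl _ _)
    · exact hne (hs.hom_eq_zero hkl _)
  calc h = (∑ a, f a ≫ g a) ≫ h ≫ ∑ b, f' b ≫ g' b := by simp [hX, hY]
    _ = 0 := by
      simp only [Preadditive.sum_comp, Preadditive.comp_sum, Category.assoc]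
      refine Finset.sum_eq_zero fun b _ => Finset.sum_eq_zero fun a _ => ?_
      have := congrArg (fun t => f a ≫ t ≫ g' b) (h₀ a b)
      simpa using this

theorem exists_comp_ne_zero {X Y : D} {f : X ⟶ Y} (hf : f ≠ 0) : ∃ q : Y ⟶ X, f ≫ q ≠ 0 := by
  obtain ⟨i, p, q, h⟩ := hs.exists_comp_eq_id hf
  refine ⟨q ≫ p, fun h0 => ?_⟩
  have h₁ : p = 0 := by
    have := congrArg (fun t => p ≫ t) h0
    rw [← Category.assoc f, ← Category.assoc p, h, Category.id_comp, comp_zero] at this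
    exact this
  exact hs.id_ne_zero i (by rw [← h, h₁, zero_comp])

theorem exists_iso {X : D} (hX : 𝟙 X ≠ 0) (hend : ∀ f : X ⟶ X, ∃ c : ℂ, f = c • 𝟙 X) :
    ∃ i, Nonempty (s i ≅ X) := by
  obtain ⟨i, p, q, h⟩ := hs.exists_comp_eq_id hX
  rw [Category.id_comp] at h
  obtain ⟨c, hc⟩ := hend (q ≫ p)
  have h₁ : c • p = p := by
    have := congrArg (fun t => p ≫ t) hc
    rw [reassoc_of% h, Linear.comp_smul, Category.comp_id] at this
    exact this.symm
  have hp : p ≠ 0 := by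
    rintro rfl
    exact hs.id_ne_zero i (by rw [← h, zero_comp])
  have hc1 : c = 1 := by
    have : (c - 1) • p = 0 := by rw [sub_smul, h₁, one_smul, sub_self]
    rcases smul_eq_zero.1 this with h0 | h0
    · exact sub_eq_zero.1 h0
    · exact absurd h0 hp
  exact ⟨i, ⟨⟨p, q, h, by rw [hc, hc1, one_smul]⟩⟩⟩

theorem hom_eq_smul_of_iso {i : ι} {X : D} (φ : s i ≅ X) (f : s i ⟶ X) :
    ∃ c : ℂ, f = c • φ.hom := by
  obtain ⟨c, hc⟩ := hs.end_eq_smul (f ≫ φ.inv)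
  exact ⟨c, by rw [← Category.comp_id f, ← φ.inv_hom_id, ← Category.assoc, hc, Linear.smul_comp,
    Category.id_comp]⟩

theorem hom_eq_smul_of_iso' {i : ι} {X : D} (φ : s i ≅ X) (f : X ⟶ s i) :
    ∃ c : ℂ, f = c • φ.inv := by
  obtain ⟨c, hc⟩ := hs.end_eq_smul (φ.hom ≫ f)
  exact ⟨c, by rw [← Category.id_comp f, ← φ.inv_hom_id, Category.assoc, hc, Linear.comp_smul,
    Category.comp_id]⟩

theorem comp_map_eq (F : D ⥤ D) [F.Additive] [F.Linear ℂ] (φ : ∀ i, s i ≅ F.obj (s i)) {i j : ι}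
    (f : s i ⟶ s j) : f ≫ (φ j).hom = (φ i).hom ≫ F.map f := by
  by_cases hij : i = j
  · subst hij
    obtain ⟨c, rfl⟩ := hs.end_eq_smul f
    simp
  · rw [hs.hom_eq_zero hij f]
    simp

/-- Isomorphisms on a simple family extend to a natural isomorphism. -/
theorem exists_natIso (F : D ⥤ D) [F.Additive] [F.Linear ℂ] (φ : ∀ i, s i ≅ F.obj (s i)) :
    ∃ Φ : 𝟭 D ≅ F, ∀ i, Φ.hom.app (s i) = (φ i).hom := by
  choose n k f g hfg using hs.decomposition
  have hφ := fun {i j} (f : s i ⟶ s j) => hs.comp_map_eq F φ f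
  have hφ' : ∀ {i j} (f : s i ⟶ s j), F.map f ≫ (φ j).inv = (φ i).inv ≫ f := fun f => by
    rw [Iso.comp_inv_eq, Category.assoc, hφ, Iso.inv_hom_id_assoc]
  have hF : ∀ X, ∑ a, F.map (f X a) ≫ F.map (g X a) = 𝟙 (F.obj X) := fun X => by
    simp only [← F.map_comp, ← F.map_sum, hfg, F.map_id]
  have hnat : ∀ {X Y : D} (h : X ⟶ Y),
      h ≫ ∑ b, f Y b ≫ (φ (k Y b)).hom ≫ F.map (g Y b) =
        (∑ a, f X a ≫ (φ (k X a)).hom ≫ F.map (g X a)) ≫ F.map h := fun {X Y} h => by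
    calc _ = (∑ a, f X a ≫ g X a) ≫ h ≫ ∑ b, f Y b ≫ (φ (k Y b)).hom ≫ F.map (g Y b) := by
          rw [hfg, Category.id_comp]
      _ = (∑ a, f X a ≫ (φ (k X a)).hom ≫ F.map (g X a)) ≫ F.map h ≫
            ∑ b, F.map (f Y b) ≫ F.map (g Y b) := by
          simp only [Preadditive.sum_comp, Preadditive.comp_sum, Category.assoc]
          refine Finset.sum_congr rfl fun b _ => Finset.sum_congr rfl fun a _ => ?_
          have := hφ (g X a ≫ h ≫ f Y b)
          simp only [Category.assoc, F.map_comp] at this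
          rw [reassoc_of% this]
      _ = _ := by rw [hF, Category.comp_id]
  have key : ∀ X, ∀ a b, (g X a ≫ f X b) ≫ (φ (k X b)).hom =
      (φ (k X a)).hom ≫ F.map (g X a) ≫ F.map (f X b) := fun X a b => by
    rw [hφ, F.map_comp]
  have key' : ∀ X, ∀ a b, F.map (g X a) ≫ F.map (f X b) ≫ (φ (k X b)).inv =
      (φ (k X a)).inv ≫ g X a ≫ f X b := fun X a b => by
    rw [← hφ', F.map_comp, Category.assoc]
  refine ⟨NatIso.ofComponents (fun X =>
    { hom := ∑ a, f X a ≫ (φ (k X a)).hom ≫ F.map (g X a)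
      inv := ∑ a, F.map (f X a) ≫ (φ (k X a)).inv ≫ g X a
      hom_inv_id := ?_
      inv_hom_id := ?_ }) (fun h => hnat h), fun i => ?_⟩
  · calc _ = (∑ a, f X a ≫ g X a) ≫ ∑ b, f X b ≫ g X b := by
          simp only [Preadditive.sum_comp, Preadditive.comp_sum, Category.assoc]
          refine Finset.sum_congr rfl fun b _ => Finset.sum_congr rfl fun a _ => ?_
          have := key' X a b
          rw [reassoc_of% this, Iso.hom_inv_id_assoc]
      _ = 𝟙 X := by rw [hfg, Category.id_comp]
  · calc _ = (∑ a, F.map (f X a) ≫ F.map (g X a)) ≫ ∑ b, F.map (f X b) ≫ F.map (g X b) := by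
          simp only [Preadditive.sum_comp, Preadditive.comp_sum, Category.assoc]
          refine Finset.sum_congr rfl fun b _ => Finset.sum_congr rfl fun a _ => ?_
          have := key X a b
          rw [Category.assoc] at this
          rw [reassoc_of% this, Iso.inv_hom_id_assoc]
      _ = _ := by rw [hF, Category.id_comp]
  · change ∑ a, f (s i) a ≫ (φ (k (s i) a)).hom ≫ F.map (g (s i) a) = _
    calc _ = (∑ a, f (s i) a ≫ g (s i) a) ≫ (φ i).hom := by
          simp only [Preadditive.sum_comp, Category.assoc]
          exact Finset.sum_congr rfl fun a _ => by rw [← hφ]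
      _ = _ := by rw [hfg, Category.id_comp]

end SimpleFamily

end SimpleFamily

section LinearDual

open ExactPairing

variable {D : Type u} [Category.{v} D] [Preadditive D] [MonoidalCategory D]
  [MonoidalPreadditive D]

theorem rightAdjointMate_add {X Y : D} [HasRightDual X] [HasRightDual Y] (f g : X ⟶ Y) :
    (f + g)ᘁ = fᘁ + gᘁ := by
  simp [rightAdjointMate, Preadditive.comp_add, Preadditive.add_comp]

theorem trRight_add {X : D} (Y : D) {Z : D} [ExactPairing X Y] [ExactPairing Y Z] (f g : X ⟶ Z) :
    trRight Y (f + g) = trRight Y f + trRight Y g := by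
  simp [trRight, Preadditive.comp_add, Preadditive.add_comp]

theorem trRight_sum {X : D} (Y : D) {Z : D} [ExactPairing X Y] [ExactPairing Y Z] {n : ℕ}
    (f : Fin n → (X ⟶ Z)) :
    trRight Y (∑ a, f a) = ∑ a, trRight Y (f a) := by
  simp [trRight, sum_whiskerRight, Preadditive.sum_comp, Preadditive.comp_sum]

theorem trLeft_sum {X : D} (Y : D) {Z : D} [ExactPairing X Y] [ExactPairing Y Z] {n : ℕ}
    (f : Fin n → (Z ⟶ X)) :
    trLeft Y (∑ a, f a) = ∑ a, trLeft Y (f a) := by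
  simp [trLeft, whiskerLeft_sum, Preadditive.sum_comp, Preadditive.comp_sum]

theorem coevaluation_ne_zero {X Y : D} [ExactPairing X Y] (h : 𝟙 X ≠ 0) : η_ X Y ≠ 0 := by
  intro h0
  have := evaluation_coevaluation X Y
  rw [h0, MonoidalPreadditive.zero_whiskerRight, zero_comp] at this
  refine h ?_
  rw [← cancel_epi (λ_ X).hom, ← cancel_mono (ρ_ X).inv, Category.comp_id, ← this]
  simp

variable [Linear ℂ D]

/-- There is a morphism with nonzero right trace. -/
theorem SimpleFamily.exists_trRight_ne_zero {ι : Type*} {s : ι → D}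
    (hs : SimpleFamily s) {X Y Z : D} [ExactPairing X Y] [ExactPairing Y Z]
    (hX : 𝟙 X ≠ 0) :
    ∃ g : X ⟶ Z, trRight Y g ≠ 0 := by
  obtain ⟨q, hq⟩ := hs.exists_comp_ne_zero (coevaluation_ne_zero (Y := Y) hX)
  refine ⟨tensorRightHomEquiv X Y Z (𝟙_ D) q ≫ (λ_ Z).hom, ?_⟩
  have : q = (tensorRightHomEquiv X Y Z (𝟙_ D) q ≫ (λ_ Z).hom) ▷ Y ≫ ε_ Y Z := by
    conv_lhs => rw [← (tensorRightHomEquiv X Y Z (𝟙_ D)).symm_apply_apply q]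
    dsimp only [tensorRightHomEquiv, Equiv.coe_fn_symm_mk]
    monoidal
  rw [trRight, ← this]
  exact hq

/-- There is a morphism with nonzero left trace. -/
theorem SimpleFamily.exists_trLeft_ne_zero {ι : Type*} {s : ι → D}
    (hs : SimpleFamily s) {X Y Z : D} [ExactPairing X Y] [ExactPairing Y Z]
    (hY : 𝟙 Y ≠ 0) :
    ∃ g : Z ⟶ X, trLeft Y g ≠ 0 := by
  obtain ⟨q, hq⟩ := hs.exists_comp_ne_zero (coevaluation_ne_zero (Y := Z) hY)
  refine ⟨tensorLeftHomEquiv Z X Y (𝟙_ D) q ≫ (ρ_ X).hom, ?_⟩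
  have : q = Y ◁ (tensorLeftHomEquiv Z X Y (𝟙_ D) q ≫ (ρ_ X).hom) ≫ ε_ X Y := by
    conv_lhs => rw [← (tensorLeftHomEquiv Z X Y (𝟙_ D)).symm_apply_apply q]
    dsimp only [tensorLeftHomEquiv, Equiv.coe_fn_symm_mk]
    monoidal
  rw [trLeft, ← this]
  exact hq

variable [MonoidalLinear ℂ D]

theorem rightAdjointMate_smul {X Y : D} [HasRightDual X] [HasRightDual Y] (c : ℂ) (f : X ⟶ Y) :
    (c • f)ᘁ = c • fᘁ := by
  simp [rightAdjointMate]

instance doubleDual_additive [RightRigidCategory D] : (doubleDual D).Additive where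
  map_add {X Y f g} := by
    change rightAdjointMate (rightAdjointMate (f + g)) = _
    rw [rightAdjointMate_add, rightAdjointMate_add]
    rfl

instance doubleDual_linear [RightRigidCategory D] : (doubleDual D).Linear ℂ where
  map_smul {X Y} f c := by
    change rightAdjointMate (rightAdjointMate (c • f)) = _
    rw [rightAdjointMate_smul, rightAdjointMate_smul]
    rfl

section

variable {X : D} (Y : D) {Z : D} [ExactPairing X Y] [ExactPairing Y Z]

theorem trRight_smul (c : ℂ) (f : X ⟶ Z) : trRight Y (c • f) = c • trRight Y f := by
  simp [trRight]

theorem trLeft_smul (c : ℂ) (f : Z ⟶ X) : trLeft Y (c • f) = c • trLeft Y f := by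
  simp [trLeft]

end

variable {ι : Type*} {s : ι → D} (hs : SimpleFamily s)
include hs

theorem SimpleFamily.trRight_ne_zero {i : ι} {Y Z : D} [ExactPairing (s i) Y] [ExactPairing Y Z]
    (φ : s i ≅ Z) : trRight Y φ.hom ≠ 0 := by
  obtain ⟨g, hg⟩ := hs.exists_trRight_ne_zero (Y := Y) (Z := Z) (hs.id_ne_zero i)
  obtain ⟨c, rfl⟩ := hs.hom_eq_smul_of_iso φ g
  rw [trRight_smul] at hg
  exact right_ne_zero_of_smul hg

theorem SimpleFamily.trLeft_ne_zero {i : ι} {Y Z : D} [ExactPairing (s i) Y] [ExactPairing Y Z]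
    (hY : 𝟙 Y ≠ 0) (φ : s i ≅ Z) : trLeft Y φ.inv ≠ 0 := by
  obtain ⟨g, hg⟩ := hs.exists_trLeft_ne_zero (X := s i) (Y := Y) (Z := Z) hY
  obtain ⟨c, rfl⟩ := hs.hom_eq_smul_of_iso' φ g
  rw [trLeft_smul] at hg
  exact right_ne_zero_of_smul hg

end LinearDual

section Spherical

open ExactPairing

theorem isSpherical_refl_unit {C : Type u} [Category.{v} C] [MonoidalCategory C] :
    IsSpherical (𝟙_ C) (Iso.refl (𝟙_ C)) := by
  intro E
  change (ρ_ (𝟙_ C)).inv ≫ (E ≫ 𝟙 _) ▷ 𝟙_ C ≫ (ρ_ (𝟙_ C)).hom =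
    (ρ_ (𝟙_ C)).inv ≫ 𝟙_ C ◁ (𝟙 _ ≫ E) ≫ (ρ_ (𝟙_ C)).hom
  have h₁ : (ρ_ (𝟙_ C)).inv ≫ E ▷ 𝟙_ C ≫ (ρ_ (𝟙_ C)).hom = E := by simp
  have h₂ : (λ_ (𝟙_ C)).inv ≫ 𝟙_ C ◁ E ≫ (λ_ (𝟙_ C)).hom = E := by simp
  rw [Category.comp_id, Category.id_comp, h₁, ← unitors_equal, ← unitors_inv_equal, h₂]

section

variable {D : Type u} [Category.{v} D] [MonoidalCategory D] [RightRigidCategory D]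

/-- The components of a natural isomorphism `Id ≅ **`. -/
noncomputable def pivot (Φ : 𝟭 D ≅ doubleDual D) (X : D) : X ≅ (Xᘁ)ᘁ := Φ.app X

theorem pivot_hom_naturality (Φ : 𝟭 D ≅ doubleDual D) {X Y : D} (f : X ⟶ Y) :
    f ≫ (pivot Φ Y).hom = (pivot Φ X).hom ≫ (fᘁ)ᘁ :=
  Φ.hom.naturality f

theorem pivot_inv_naturality (Φ : 𝟭 D ≅ doubleDual D) {X Y : D} (f : X ⟶ Y) :
    (fᘁ)ᘁ ≫ (pivot Φ Y).inv = (pivot Φ X).inv ≫ f :=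
  Φ.inv.naturality f

theorem pivot_doubleDual (Φ : 𝟭 D ≅ doubleDual D) (X : D) :
    ((pivot Φ X).homᘁ)ᘁ = (pivot Φ ((Xᘁ)ᘁ)).hom := by
  rw [← cancel_epi (pivot Φ X).hom, ← pivot_hom_naturality]

/-- The square of a natural isomorphism `Id ≅ **`, as a natural isomorphism `**** ≅ Id`. -/
noncomputable def quadrupleDualIso (Φ : 𝟭 D ≅ doubleDual D) : quadrupleDual D ≅ 𝟭 D :=
  NatIso.hcomp Φ.symm Φ.symm

theorem quadrupleDualIso_hom_app (Φ : 𝟭 D ≅ doubleDual D) (X : D) :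
    (quadrupleDualIso Φ).hom.app X = (pivot Φ ((Xᘁ)ᘁ)).inv ≫ (pivot Φ X).inv := by
  simp [quadrupleDualIso, pivot]
  rfl

theorem trRight_cyclic (Φ : 𝟭 D ≅ doubleDual D) {X Y : D} (f : X ⟶ Y) (g : Y ⟶ X) :
    trRight (Xᘁ) ((f ≫ g) ≫ (pivot Φ X).hom) = trRight (Yᘁ) ((g ≫ f) ≫ (pivot Φ Y).hom) := by
  rw [Category.assoc, trRight_rotate, Category.assoc, ← pivot_hom_naturality, Category.assoc]

theorem trLeft_cyclic (Φ : 𝟭 D ≅ doubleDual D) {X Y : D} (f : X ⟶ Y) (g : Y ⟶ X) :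
    trLeft (Xᘁ) ((pivot Φ X).inv ≫ f ≫ g) = trLeft (Yᘁ) ((pivot Φ Y).inv ≫ g ≫ f) := by
  rw [← Category.assoc, trLeft_rotate, ← Category.assoc ((gᘁ)ᘁ), pivot_inv_naturality,
    Category.assoc]

end

variable {D : Type u} [Category.{v} D] [Preadditive D] [Linear ℂ D] [MonoidalCategory D]
  [MonoidalPreadditive D] [RightRigidCategory D]

/-- Sphericality on a simple family implies sphericality on all objects. -/
theorem SimpleFamily.isSpherical {ι : Type*} {s : ι → D} (hs : SimpleFamily s)
    {Φ : 𝟭 D ≅ doubleDual D} (hΦ : ∀ i, IsSpherical ((s i)ᘁ) (pivot Φ (s i)))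
    (X : D) :
    IsSpherical (Xᘁ) (pivot Φ X) := by
  intro E
  obtain ⟨n, k, f, g, hX⟩ := hs.decomposition X
  have h₁ : E ≫ (pivot Φ X).hom = ∑ a, ((E ≫ f a) ≫ g a) ≫ (pivot Φ X).hom := by
    rw [← Preadditive.sum_comp]
    simp only [Category.assoc]
    rw [← Preadditive.comp_sum, hX, Category.comp_id]
  have h₂ : (pivot Φ X).inv ≫ E = ∑ a, (pivot Φ X).inv ≫ f a ≫ g a ≫ E := by
    rw [← Preadditive.comp_sum]
    simp only [← Category.assoc (f _)]
    rw [← Preadditive.sum_comp, hX, Category.id_comp]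
  rw [h₁, h₂, trRight_sum, trLeft_sum]
  refine Finset.sum_congr rfl fun a _ => ?_
  rw [trRight_cyclic, hΦ, ← Category.assoc (g a), trLeft_cyclic]

variable [MonoidalLinear ℂ D]

namespace SimpleFamily

variable {ι : Type*} {s : ι → D} (hs : SimpleFamily s) {Φ : 𝟭 D ≅ doubleDual D}
include hs

theorem eq_zero_of_trRight_eq_zero (Φ : 𝟭 D ≅ doubleDual D) {X : D} {h : X ⟶ X}
    (h0 : ∀ E : X ⟶ X, trRight (Xᘁ) ((E ≫ h) ≫ (pivot Φ X).hom) = 0) : h = 0 := by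
  by_contra hne
  obtain ⟨i, p, q, hpq⟩ := hs.exists_comp_eq_id hne
  have h₁ := h0 (q ≫ p)
  rw [Category.assoc q, trRight_cyclic, Category.assoc p, hpq, Category.id_comp] at h₁
  exact hs.trRight_ne_zero (pivot Φ (s i)) h₁

/-- Two spherical isomorphisms `X ≅ X**` differ by an involution. -/
theorem comp_inv_eq (hΦ : ∀ i, IsSpherical ((s i)ᘁ) (pivot Φ (s i))) {X : D} (ψ : X ≅ (Xᘁ)ᘁ)
    (hψ : IsSpherical (Xᘁ) ψ) :
    ψ.hom ≫ (pivot Φ X).inv = (pivot Φ X).hom ≫ ψ.inv := by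
  rw [← sub_eq_zero]
  refine hs.eq_zero_of_trRight_eq_zero Φ fun E => ?_
  have hX := hs.isSpherical hΦ X
  have h₁ : trRight (Xᘁ) ((E ≫ ψ.hom ≫ (pivot Φ X).inv) ≫ (pivot Φ X).hom) =
      trRight (Xᘁ) ((E ≫ (pivot Φ X).hom ≫ ψ.inv) ≫ (pivot Φ X).hom) := by
    have e := hX (((pivot Φ X).hom ≫ ψ.inv) ≫ E)
    rw [Category.assoc (pivot Φ X).hom, Iso.inv_hom_id_assoc, ← hψ] at e
    rw [trRight_cyclic Φ E ((pivot Φ X).hom ≫ ψ.inv), Category.assoc (pivot Φ X).hom, e]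
    simp
  have h₂ : (E ≫ (ψ.hom ≫ (pivot Φ X).inv - (pivot Φ X).hom ≫ ψ.inv)) ≫ (pivot Φ X).hom =
      (E ≫ ψ.hom ≫ (pivot Φ X).inv) ≫ (pivot Φ X).hom +
        (-1 : ℂ) • ((E ≫ (pivot Φ X).hom ≫ ψ.inv) ≫ (pivot Φ X).hom) := by
    rw [Preadditive.comp_sub, Preadditive.sub_comp, neg_smul, one_smul, sub_eq_add_neg]
  rw [h₂, trRight_add, trRight_smul, h₁, neg_smul, one_smul, add_neg_cancel]

end SimpleFamily

theorem SimpleFamily.pivot_inv_comp_pivot_inv {ι : Type*} {s : ι → D} (hs : SimpleFamily s)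
    {Φ : 𝟭 D ≅ doubleDual D} (hΦ : ∀ i, IsSpherical ((s i)ᘁ) (pivot Φ (s i))) {U : D}
    [p : ExactPairing U U] (hU : IsSpherical U (Iso.refl U)) :
    (pivot Φ ((Uᘁ)ᘁ)).inv ≫ (pivot Φ U).inv =
      ((doubleDualComparison p p).homᘁ)ᘁ ≫ (doubleDualComparison p p).hom := by
  have key := hs.comp_inv_eq hΦ (doubleDualComparison p p).symm
    ((isSpherical_comparison_iff _).2 (by rwa [Iso.symm_self_id]))
  rw [Iso.symm_hom, Iso.symm_inv, Iso.inv_comp_eq] at key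
  rw [Iso.inv_comp_eq, ← reassoc_of% pivot_hom_naturality Φ (doubleDualComparison p p).hom]
  exact key

theorem SimpleFamily.isMonoidalQuadrupleDualIso {ι : Type*} {s : ι → D} (hs : SimpleFamily s)
    {Φ : 𝟭 D ≅ doubleDual D} (hΦ : ∀ i, IsSpherical ((s i)ᘁ) (pivot Φ (s i))) :
    IsMonoidalQuadrupleDualIso (quadrupleDualIso Φ) := by
  refine ⟨fun X Y => ?_, ?_⟩
  · let c : ∀ A B : D, ((A ⊗ B)ᘁ)ᘁ ≅ (Aᘁ)ᘁ ⊗ (Bᘁ)ᘁ := doubleDualTensor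
    have key : ∀ A B : D, ((pivot Φ A).hom ⊗ₘ (pivot Φ B).hom) ≫ (c A B).inv ≫
        (pivot Φ (A ⊗ B)).inv =
        (pivot Φ (A ⊗ B)).hom ≫ (c A B).hom ≫
          ((pivot Φ A).inv ⊗ₘ (pivot Φ B).inv) := fun A B => by
      have h := hs.comp_inv_eq hΦ ((pivot Φ A ⊗ᵢ pivot Φ B) ≪≫ (c A B).symm)
        ((isSpherical_comparison_iff (X := A ⊗ B) (Y := Bᘁ ⊗ Aᘁ) (Z := (Aᘁ)ᘁ ⊗ (Bᘁ)ᘁ) _).2 (by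
          rw [Iso.trans_assoc]
          change IsSpherical _ (_ ≪≫ (c A B).symm ≪≫ c A B)
          rw [Iso.symm_self_id, Iso.trans_refl]
          exact (hs.isSpherical hΦ A).tensor (hs.isSpherical hΦ B)))
      simpa using h
    have h₁ : (((pivot Φ X).hom ⊗ₘ (pivot Φ Y).hom)ᘁ)ᘁ ≫ (c ((Xᘁ)ᘁ) ((Yᘁ)ᘁ)).hom =
        (c X Y).hom ≫ (((pivot Φ X).homᘁ)ᘁ ⊗ₘ ((pivot Φ Y).homᘁ)ᘁ) :=
      doubleDualTensor_naturality (pivot Φ X).hom (pivot Φ Y).hom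
    rw [pivot_doubleDual, pivot_doubleDual] at h₁
    have h₂ := key ((Xᘁ)ᘁ) ((Yᘁ)ᘁ)
    rw [← Iso.inv_comp_eq] at h₂
    have h₃ := pivot_inv_naturality Φ ((pivot Φ X).hom ⊗ₘ (pivot Φ Y).hom)
    rw [quadrupleDualIso_hom_app, quadrupleDualIso_hom_app, quadrupleDualIso_hom_app]
    change _ = (((c X Y).homᘁ)ᘁ ≫ (c ((Xᘁ)ᘁ) ((Yᘁ)ᘁ)).hom) ≫
      (((pivot Φ ((Xᘁ)ᘁ)).inv ≫ (pivot Φ X).inv : _ ⟶ X) ⊗ₘ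
        ((pivot Φ ((Yᘁ)ᘁ)).inv ≫ (pivot Φ Y).inv : _ ⟶ Y))
    rw [← tensorHom_comp_tensorHom, Category.assoc, ← reassoc_of% h₂,
      reassoc_of% pivot_inv_naturality Φ (c X Y).hom, ← Category.assoc (c X Y).hom, ← h₁, Category.assoc, Iso.hom_inv_id_assoc,
      reassoc_of% h₃, tensorHom_comp_tensorHom, Iso.hom_inv_id, Iso.hom_inv_id,
      id_tensorHom_id, Category.comp_id]
  · exact (quadrupleDualIso_hom_app Φ (𝟙_ D)).trans
      (hs.pivot_inv_comp_pivot_inv hΦ (U := 𝟙_ D) isSpherical_refl_unit)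

end Spherical

section DualOfSimple

open ExactPairing

theorem exists_rightAdjointMate_eq {C : Type u} [Category.{v} C] [MonoidalCategory C] {X Y : C}
    [HasRightDual X] [HasRightDual Y] (g : (Yᘁ : C) ⟶ Xᘁ) : ∃ f : X ⟶ Y, fᘁ = g := by
  let e := tensorRightHomEquiv (𝟙_ C) X (Xᘁ) Y
  refine ⟨(λ_ X).inv ≫ e.symm (η_ Y (Yᘁ) ≫ Y ◁ g), whiskerLeft_cancel_coevaluation (X := Y) ?_⟩
  rw [coevaluation_comp_rightAdjointMate]
  conv_rhs => rw [← e.apply_symm_apply (η_ Y (Yᘁ) ≫ Y ◁ g)]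
  generalize e.symm (η_ Y (Yᘁ) ≫ Y ◁ g) = k
  dsimp only [e, tensorRightHomEquiv, Equiv.coe_fn_mk]
  monoidal

variable {D : Type u} [Category.{v} D] [Preadditive D]

theorem SimpleFamily.nonempty_iso_of_ne_zero {ι : Type*} {s : ι → D}
    [Linear ℂ D] (hs : SimpleFamily s) {i : ι} {X : D} (hX : 𝟙 X ≠ 0)
    (hend : ∀ f : X ⟶ X, ∃ c : ℂ, f = c • 𝟙 X) {f : s i ⟶ X} (hf : f ≠ 0) :
    Nonempty (s i ≅ X) := by
  obtain ⟨j, ⟨ψ⟩⟩ := hs.exists_iso hX hend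
  by_cases hij : i = j
  · subst hij
    exact ⟨ψ⟩
  · refine absurd ?_ hf
    rw [← cancel_mono ψ.inv, hs.hom_eq_zero hij (f ≫ ψ.inv), zero_comp]

variable [MonoidalCategory D]
  [MonoidalPreadditive D]

theorem id_rightDual_ne_zero {X Y : D} [ExactPairing X Y] (h : 𝟙 X ≠ 0) : 𝟙 Y ≠ 0 := by
  intro h0
  refine coevaluation_ne_zero (Y := Y) h ?_
  rw [← Category.comp_id (η_ X Y), ← MonoidalCategory.whiskerLeft_id, h0,
    MonoidalPreadditive.whiskerLeft_zero, comp_zero]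

variable [Linear ℂ D] [MonoidalLinear ℂ D]

theorem end_rightDual_eq_smul {X Y : D} [p : ExactPairing X Y]
    (h : ∀ f : X ⟶ X, ∃ c : ℂ, f = c • 𝟙 X) (g : Y ⟶ Y) : ∃ c : ℂ, g = c • 𝟙 Y := by
  let _ : HasRightDual X := ⟨Y⟩
  obtain ⟨f, rfl⟩ := exists_rightAdjointMate_eq (X := X) (Y := X) g
  obtain ⟨c, rfl⟩ := h f
  refine ⟨c, ?_⟩
  rw [rightAdjointMate_smul, rightAdjointMate_id]
  rfl

namespace SimpleFamily

variable {ι : Type*} {s : ι → D} (hs : SimpleFamily s)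
include hs

theorem nonempty_iso_doubleDual {i : ι} (Y : D) {Z : D} [ExactPairing (s i) Y]
    [ExactPairing Y Z] : Nonempty (s i ≅ Z) := by
  obtain ⟨g, hg⟩ := hs.exists_trRight_ne_zero (Y := Y) (Z := Z) (hs.id_ne_zero i)
  refine hs.nonempty_iso_of_ne_zero (f := g) ?_ ?_ ?_
  · exact id_rightDual_ne_zero (X := Y) (id_rightDual_ne_zero (X := s i) (hs.id_ne_zero i))
  · exact end_rightDual_eq_smul (X := Y) (end_rightDual_eq_smul (X := s i) hs.end_eq_smul)
  · rintro rfl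
    exact hg (by simp [trRight])

theorem isSpherical_of_trRight_eq_trLeft {i : ι} {Y Z : D} [ExactPairing (s i) Y]
    [ExactPairing Y Z] (φ : s i ≅ Z) (h : trRight Y φ.hom = trLeft Y φ.inv) :
    IsSpherical Y φ := by
  intro E
  obtain ⟨c, rfl⟩ := hs.end_eq_smul E
  rw [Linear.smul_comp, Linear.comp_smul, Category.id_comp, Category.comp_id, trRight_smul,
    trLeft_smul, h]

theorem exists_isSpherical (hunit : ∀ f : 𝟙_ D ⟶ 𝟙_ D, ∃ c : ℂ, f = c • 𝟙 (𝟙_ D))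
    {i : ι} {Y Z : D} [ExactPairing (s i) Y] [ExactPairing Y Z] (φ : s i ≅ Z) :
    ∃ ψ : s i ≅ Z, IsSpherical Y ψ := by
  obtain ⟨a, ha⟩ := hunit (trRight Y φ.hom)
  obtain ⟨b, hb⟩ := hunit (trLeft Y φ.inv)
  have ha₀ : a ≠ 0 := by
    rintro rfl
    exact hs.trRight_ne_zero (Y := Y) φ (by rw [ha, zero_smul])
  have hb₀ : b ≠ 0 := by
    rintro rfl
    exact hs.trLeft_ne_zero (id_rightDual_ne_zero (X := s i) (hs.id_ne_zero i)) φ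
      (by rw [hb, zero_smul])
  obtain ⟨r, hr⟩ := IsAlgClosed.exists_eq_mul_self (b / a)
  have hr₀ : r ≠ 0 := by
    rintro rfl
    rw [mul_zero, div_eq_zero_iff] at hr
    exact hr.elim hb₀ ha₀
  refine ⟨⟨r • φ.hom, r⁻¹ • φ.inv, ?_, ?_⟩, hs.isSpherical_of_trRight_eq_trLeft _ ?_⟩
  · simp [smul_smul, hr₀]
  · simp [smul_smul, hr₀]
  · rw [trRight_smul, trLeft_smul, ha, hb, smul_smul, smul_smul]
    congr 1
    field_simp
    rw [pow_two, ← hr, div_mul_cancel₀ b ha₀]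

/-- A right rigid category with a simple family has a monoidal isomorphism from the quadruple dual
functor to the identity. -/
theorem exists_isMonoidalQuadrupleDualIso [RightRigidCategory D]
    (hunit : ∀ f : 𝟙_ D ⟶ 𝟙_ D, ∃ c : ℂ, f = c • 𝟙 (𝟙_ D)) :
    ∃ e : quadrupleDual D ≅ 𝟭 D, IsMonoidalQuadrupleDualIso e := by
  choose φ hφ using fun i =>
    (hs.nonempty_iso_doubleDual (i := i) ((s i)ᘁ) (Z := ((s i)ᘁ)ᘁ)).elim
    (fun ψ => hs.exists_isSpherical hunit (Y := (s i)ᘁ) ψ)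
  obtain ⟨Φ, hΦ⟩ := hs.exists_natIso (doubleDual D) φ
  refine ⟨quadrupleDualIso Φ, hs.isMonoidalQuadrupleDualIso fun i => ?_⟩
  have : pivot Φ (s i) = φ i := Iso.ext (hΦ i)
  rw [this]
  exact hφ i

end SimpleFamily

end DualOfSimple

section FusionFamily

attribute [local instance] Abelian.hasFiniteBiproducts

variable {C : Type u} [Category.{v} C] [Abelian C]

theorem Strand.nonempty_iso {x y : Strand C} {f : x.1 ⟶ y.1} (hf : f ≠ 0) :
    Nonempty (x.1 ≅ y.1) := by
  have := x.2
  have := y.2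
  have := isIso_of_hom_simple hf
  exact ⟨asIso f⟩

theorem Strand.id_ne_zero (x : Strand C) : 𝟙 x.1 ≠ 0 := by
  have := x.2
  exact id_nonzero x.1

variable [Linear ℂ C] [MonoidalCategory C] [IsFusionCategory C]

theorem exists_simple_decomposition (X : C) : ∃ (n : ℕ) (t : Fin n → Strand C)
    (f : ∀ a, X ⟶ (t a).1) (g : ∀ a, (t a).1 ⟶ X), ∑ a, f a ≫ g a = 𝟙 X := by
  obtain ⟨n, t, ht, ⟨e⟩⟩ := IsFusionCategory.semisimple X
  refine ⟨n, fun a => ⟨t a, ht a⟩, fun a => e.hom ≫ biproduct.π t a,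
    fun a => biproduct.ι t a ≫ e.inv, ?_⟩
  calc _ = e.hom ≫ (∑ a, biproduct.π t a ≫ biproduct.ι t a) ≫ e.inv := by
        simp only [Preadditive.sum_comp, Preadditive.comp_sum, Category.assoc]
    _ = 𝟙 X := by rw [biproduct.total, Category.id_comp, e.hom_inv_id]

theorem Strand.end_eq_smul (x : Strand C) (f : x.1 ⟶ x.1) : ∃ c : ℂ, f = c • 𝟙 x.1 := by
  have := x.2
  have := IsFusionCategory.finite_hom x.1 x.1
  obtain ⟨c, hc⟩ := endomorphism_simple_eq_smul_id ℂ f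
  exact ⟨c, hc.symm⟩

theorem end_unit_eq_smul (f : 𝟙_ C ⟶ 𝟙_ C) : ∃ c : ℂ, f = c • 𝟙 (𝟙_ C) := by
  have h := IsFusionCategory.finrank_end_unit (C := C)
  have h₀ : 𝟙 (𝟙_ C) ≠ 0 := by
    intro h₀
    obtain ⟨v, hv, -⟩ := finrank_eq_one_iff'.1 h
    exact hv (by rw [← Category.id_comp v, h₀, zero_comp])
  obtain ⟨c, hc⟩ := (finrank_eq_one_iff_of_nonzero' _ h₀).1 h f
  exact ⟨c, hc.symm⟩

variable (C) in
theorem exists_simpleFamily : ∃ (ι : Type u) (s : ι → C), SimpleFamily s := by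
  let r : Setoid (Strand C) :=
    { r := fun x y => Nonempty (x.1 ≅ y.1)
      iseqv := ⟨fun _ => ⟨Iso.refl _⟩, fun ⟨e⟩ => ⟨e.symm⟩, fun ⟨e⟩ ⟨e'⟩ => ⟨e ≪≫ e'⟩⟩ }
  refine ⟨Quotient r, fun i => i.out.1, ?_, fun f => Strand.end_eq_smul _ f,
    fun i => Strand.id_ne_zero _, fun X => ?_⟩
  · intro i j hij f
    by_contra hf
    exact hij (Quotient.out_equiv_out.1 (Strand.nonempty_iso hf))
  · obtain ⟨n, t, f, g, h⟩ := exists_simple_decomposition X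
    have e : ∀ a, Nonempty ((Quotient.mk r (t a)).out.1 ≅ (t a).1) := fun a =>
      Quotient.mk_out (s := r) (t a)
    exact ⟨n, fun a => Quotient.mk r (t a), fun a => f a ≫ (e a).some.inv,
      fun a => (e a).some.hom ≫ g a,
      by simpa using h⟩

end FusionFamily

section IsEqToHom

variable {C : Type u} [Category.{v} C]

/-- A morphism is an identity up to equality of objects. -/
def IsEqToHom {X Y : C} (f : X ⟶ Y) : Prop := ∃ h : X = Y, f = eqToHom h

namespace IsEqToHom

theorem id (X : C) : IsEqToHom (𝟙 X) := ⟨rfl, rfl⟩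

theorem comp {X Y Z : C} {f : X ⟶ Y} {g : Y ⟶ Z} (hf : IsEqToHom f) (hg : IsEqToHom g) :
    IsEqToHom (f ≫ g) := by
  obtain ⟨rfl, rfl⟩ := hf
  obtain ⟨rfl, rfl⟩ := hg
  exact ⟨rfl, by simp⟩

theorem inv {X Y : C} {i : X ≅ Y} (h : IsEqToHom i.hom) : IsEqToHom i.inv := by
  obtain ⟨rfl, h⟩ := h
  exact ⟨rfl, by rw [← cancel_epi i.hom, i.hom_inv_id, h]; simp⟩

end IsEqToHom

end IsEqToHom

section PairingCoherence

open ExactPairing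

variable {C : Type u} [Category.{v} C] [MonoidalCategory C]

theorem tensor_unit_coevaluation (X Y : C) [ExactPairing X Y] :
    η_ (X ⊗ 𝟙_ C) (𝟙_ C ⊗ Y) ≫ ((ρ_ X).hom ⊗ₘ (λ_ Y).hom) = η_ X Y := by
  have h : η_ (𝟙_ C) (𝟙_ C) = (ρ_ (𝟙_ C)).inv := rfl
  rw [tensor_coevaluation, h]
  monoidal

theorem unit_tensor_coevaluation (X Y : C) [ExactPairing X Y] :
    η_ (𝟙_ C ⊗ X) (Y ⊗ 𝟙_ C) ≫ ((λ_ X).hom ⊗ₘ (ρ_ Y).hom) = η_ X Y := by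
  have h : η_ (𝟙_ C) (𝟙_ C) = (ρ_ (𝟙_ C)).inv := rfl
  rw [tensor_coevaluation, h]
  monoidal

theorem tensor_assoc_coevaluation (X₁ Y₁ X₂ Y₂ X₃ Y₃ : C) [ExactPairing X₁ Y₁]
    [ExactPairing X₂ Y₂] [ExactPairing X₃ Y₃] :
    η_ (X₁ ⊗ X₂ ⊗ X₃) ((Y₃ ⊗ Y₂) ⊗ Y₁) ≫ ((α_ X₁ X₂ X₃).inv ⊗ₘ (α_ Y₃ Y₂ Y₁).hom) =
      η_ ((X₁ ⊗ X₂) ⊗ X₃) (Y₃ ⊗ Y₂ ⊗ Y₁) := by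
  rw [tensor_coevaluation, tensor_coevaluation, tensor_coevaluation, tensor_coevaluation]
  monoidal

namespace IsEqToHom

theorem tensorHom {X Y X' Y' : C} {f : X ⟶ Y} {g : X' ⟶ Y'} (hf : IsEqToHom f)
    (hg : IsEqToHom g) : IsEqToHom (f ⊗ₘ g) := by
  obtain ⟨rfl, rfl⟩ := hf
  obtain ⟨rfl, rfl⟩ := hg
  exact ⟨rfl, by simp⟩

theorem rightAdjointMate [RightRigidCategory C] {X Y : C} {f : X ⟶ Y} (hf : IsEqToHom f) :
    IsEqToHom (rightAdjointMate f) := by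
  obtain ⟨rfl, rfl⟩ := hf
  exact ⟨rfl, by simp⟩

theorem doubleDualComparison [RightRigidCategory C] {X Y Z : C} {p : ExactPairing X Y}
    {q : ExactPairing Y Z}
    (hp : IsEqToHom (rightDualIso (RightRigidCategory.rightDual X).exact p).hom)
    (hq : IsEqToHom (rightDualIso (RightRigidCategory.rightDual Y).exact q).hom) :
    IsEqToHom (doubleDualComparison p q).hom :=
  hp.inv.rightAdjointMate.comp hq

end IsEqToHom

/-- Two exact pairings agree up to equality of objects. -/
def PairingEq {X Y X' Y' : C} (p : ExactPairing X Y) (p' : ExactPairing X' Y') : Prop :=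
  ∃ (f : X ⟶ X') (g : Y ⟶ Y'), IsEqToHom f ∧ IsEqToHom g ∧
    p.coevaluation' ≫ (f ⊗ₘ g) = p'.coevaluation'

namespace PairingEq

theorem refl {X Y : C} (p : ExactPairing X Y) : PairingEq p p :=
  ⟨_, _, .id X, .id Y, by simp⟩

theorem symm {X Y X' Y' : C} {p : ExactPairing X Y} {p' : ExactPairing X' Y'}
    (h : PairingEq p p') : PairingEq p' p := by
  obtain ⟨_, _, ⟨rfl, rfl⟩, ⟨rfl, rfl⟩, h⟩ := h
  exact ⟨_, _, .id _, .id _, by rw [← h]; simp⟩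

theorem trans {X Y X' Y' X'' Y'' : C} {p : ExactPairing X Y} {p' : ExactPairing X' Y'}
    {p'' : ExactPairing X'' Y''} (h : PairingEq p p') (h' : PairingEq p' p'') :
    PairingEq p p'' := by
  obtain ⟨f, g, hf, hg, h⟩ := h
  obtain ⟨f', g', hf', hg', h'⟩ := h'
  exact ⟨f ≫ f', g ≫ g', hf.comp hf', hg.comp hg', by
    rw [← h', ← h, Category.assoc, tensorHom_comp_tensorHom]⟩

theorem tensor {X₁ Y₁ X₂ Y₂ X₁' Y₁' X₂' Y₂' : C} {p₁ : ExactPairing X₁ Y₁}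
    {p₂ : ExactPairing X₂ Y₂} {p₁' : ExactPairing X₁' Y₁'} {p₂' : ExactPairing X₂' Y₂'}
    (h₁ : PairingEq p₁ p₁') (h₂ : PairingEq p₂ p₂') :
    PairingEq (@ExactPairing.tensor _ _ _ _ _ _ _ p₁ p₂)
      (@ExactPairing.tensor _ _ _ _ _ _ _ p₁' p₂') := by
  obtain ⟨_, _, ⟨rfl, rfl⟩, ⟨rfl, rfl⟩, h₁⟩ := h₁
  obtain ⟨_, _, ⟨rfl, rfl⟩, ⟨rfl, rfl⟩, h₂⟩ := h₂
  refine ⟨_, _, .id _, .id _, ?_⟩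
  rw [id_tensorHom_id, Category.comp_id]
  rw [eqToHom_refl, eqToHom_refl, id_tensorHom_id, Category.comp_id] at h₁ h₂
  have e₁ : @coevaluation _ _ _ _ _ p₁ = @coevaluation _ _ _ _ _ p₁' := h₁
  have e₂ : @coevaluation _ _ _ _ _ p₂ = @coevaluation _ _ _ _ _ p₂' := h₂
  refine (@tensor_coevaluation _ _ _ _ _ _ _ p₁ p₂).trans (.trans ?_
    (@tensor_coevaluation _ _ _ _ _ _ _ p₁' p₂').symm)
  rw [e₁, e₂]

theorem isEqToHom {X Y Y' : C} {p : ExactPairing X Y} {p' : ExactPairing X Y'}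
    (h : PairingEq p p') : IsEqToHom (rightDualIso p p').hom := by
  obtain ⟨_, g, ⟨_, rfl⟩, hg, h⟩ := h
  rw [eqToHom_refl, id_tensorHom] at h
  rwa [← eq_rightDualIso_hom p p' g h]

end PairingEq

end PairingCoherence

section SkeletalStrictification

open Strictification

variable {C : Type u} [Category.{v} C] [Abelian C] [MonoidalCategory C]

/-- The tensor product of the sequence `(x)` is isomorphic to `x`. -/
def singleIso (x : Strand C) : (toBase (C := C)).obj (single x) ≅ x.1 := ρ_ x.1

theorem toBase_map_eq {x y : Strand C} (f : single x ⟶ single y) :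
    toBase.map f =
      (singleIso x).hom ≫ ((singleIso x).inv ≫ toBase.map f ≫ (singleIso y).hom) ≫
        (singleIso y).inv := by
  simp

variable [Linear ℂ C] [IsFusionCategory C]

theorem simpleFamily_of_skeletal (hC : Skeletal C) :
    SimpleFamily (fun x : Strand C => x.1) where
  hom_eq_zero hij f := by
    by_contra hf
    exact hij (Subtype.ext (hC (Strand.nonempty_iso hf)))
  end_eq_smul f := Strand.end_eq_smul _ f
  id_ne_zero := Strand.id_ne_zero
  decomposition := exists_simple_decomposition

theorem simpleFamily_single (hC : Skeletal C) :
    SimpleFamily (single : Strand C → Strictification C) where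
  hom_eq_zero {x y} hij f := by
    apply toBase.map_injective
    rw [toBase_map_eq, (simpleFamily_of_skeletal hC).hom_eq_zero hij ((singleIso x).inv ≫ _),
      zero_comp, comp_zero, Functor.map_zero]
  end_eq_smul {x} f := by
    obtain ⟨c, hc⟩ := Strand.end_eq_smul x ((singleIso x).inv ≫ toBase.map f ≫ (singleIso x).hom)
    refine ⟨c, toBase.map_injective ?_⟩
    rw [toBase_map_eq, hc, Functor.map_smul, Linear.smul_comp, Linear.comp_smul,
      Category.id_comp, Iso.hom_inv_id, CategoryTheory.Functor.map_id]
  id_ne_zero x h := by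
    refine Strand.id_ne_zero x ?_
    rw [← (singleIso x).inv_hom_id, ← Category.id_comp (singleIso x).hom,
      ← CategoryTheory.Functor.map_id, h, Functor.map_zero, zero_comp, comp_zero]
  decomposition L := by
    obtain ⟨n, t, f, g, h⟩ := exists_simple_decomposition (toBase.obj L)
    refine ⟨n, t, fun a => toBase.preimage (f a ≫ (singleIso (t a)).inv),
      fun a => toBase.preimage ((singleIso (t a)).hom ≫ g a), toBase.map_injective ?_⟩
    rw [Functor.map_sum, CategoryTheory.Functor.map_id, ← h]
    refine Finset.sum_congr rfl fun a _ => ?_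
    rw [Functor.map_comp, Functor.map_preimage, Functor.map_preimage, Category.assoc,
      Iso.inv_hom_id_assoc]

theorem end_unit_strictification_eq_smul
    (f : 𝟙_ (Strictification C) ⟶ 𝟙_ (Strictification C)) :
    ∃ c : ℂ, f = c • 𝟙 (𝟙_ (Strictification C)) := by
  obtain ⟨c, hc⟩ := end_unit_eq_smul (C := C) (toBase.map f)
  refine ⟨c, toBase.map_injective ?_⟩
  rw [hc, Functor.map_smul, CategoryTheory.Functor.map_id]
  rfl

theorem nonempty_rigidityChoice (hC : Skeletal C) : Nonempty (RigidityChoice C) := by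
  have hs := simpleFamily_of_skeletal hC
  have hdual : ∀ x : Strand C, ∃ y : Strand C, Nonempty (ExactPairing x.1 y.1) := fun x => by
    obtain ⟨⟨Y, p⟩⟩ := IsFusionCategory.rightRigid x.1
    obtain ⟨y, ⟨e⟩⟩ := hs.exists_iso (X := Y) (id_rightDual_ne_zero (X := x.1) x.id_ne_zero)
      (end_rightDual_eq_smul (X := x.1) x.end_eq_smul)
    exact ⟨y, ⟨exactPairingCongrRight e⟩⟩
  choose dual pairing using hdual
  refine ⟨⟨dual, fun x => ?_, fun x => ?_⟩⟩
  · let p := (pairing x).some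
    let q := (pairing (dual x)).some
    obtain ⟨e⟩ := hs.nonempty_iso_doubleDual (i := x) (dual x).1 (Z := (dual (dual x)).1)
    exact Subtype.ext (hC ⟨e⟩).symm
  · let _ : ExactPairing x.1 (dual x).1 := (pairing x).some
    let _ : ExactPairing (toBase.obj (single x)) (toBase.obj (single (dual x))) :=
      exactPairingCongr (singleIso x) (singleIso (dual x))
    exact ExactPairing.ofFullyFaithful toBase _ _

end SkeletalStrictification

section Rescaling

open Strictification

variable {C : Type u} [Category.{v} C] [Abelian C] [MonoidalCategory C]

namespace RigidityChoice

variable (R : RigidityChoice C)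

/-- The isomorphism `x ≅ x**` of the strictification given by `x = x**`. -/
def doubleDualIso (x : Strand C) : single x ≅ single (R.dual (R.dual x)) :=
  eqToIso (congrArg single (R.dual_dual x).symm)

theorem ptrLeft_eq (z : Strand C) (f : single z ⟶ single z) :
    R.ptrLeft z f =
      @trLeft _ _ _ _ (single (R.dual z)) _ (R.pairing z) (R.pairing (R.dual z))
        ((R.doubleDualIso z).inv ≫ f) := rfl

theorem isPseudoSpherical_iff :
    R.IsPseudoSpherical ↔ ∀ z, @IsSpherical _ _ _ _ (single (R.dual z)) _ (R.pairing z)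
      (R.pairing (R.dual z)) (R.doubleDualIso z) := Iff.rfl

theorem birth_comp_eqToHom {z w : Strand C} (h : z = w) :
    R.birth z ≫ eqToHom (congrArg single h) ▷ single (R.dual z) =
      R.birth w ≫ single w ◁ eqToHom (congrArg (fun x => single (R.dual x)) h.symm) := by
  subst h
  simp

/-- The right pseudo-trace over `z` is the left pseudo-trace over `z*`. -/
theorem ptrRight_id (z : Strand C) : R.ptrRight z (𝟙 _) = R.ptrLeft (R.dual z) (𝟙 _) := by
  have h := R.birth_comp_eqToHom (R.dual_dual z).symm
  dsimp only [ptrRight, ptrLeft, toDoubleDual]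
  rw [Category.id_comp, Category.comp_id, reassoc_of% h]

variable [Linear ℂ C] [MonoidalPreadditive C] [MonoidalLinear ℂ C] (c : Strand C → ℂˣ)

theorem ptrRight_rescale (z : Strand C) (f : single z ⟶ single z) :
    (R.rescale c).ptrRight z f = ((c z : ℂ) * (c (R.dual z) : ℂ)⁻¹) • R.ptrRight z f := by
  change ((c z : ℂ) • R.birth z) ≫ _ ▷ _ ≫ ((c (R.dual z) : ℂ)⁻¹ • R.death (R.dual z)) = _
  rw [Linear.smul_comp, Linear.comp_smul, Linear.comp_smul, smul_smul]
  rfl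

theorem ptrLeft_rescale (z : Strand C) (f : single z ⟶ single z) :
    (R.rescale c).ptrLeft z f = ((c (R.dual z) : ℂ) * (c z : ℂ)⁻¹) • R.ptrLeft z f := by
  change ((c (R.dual z) : ℂ) • R.birth (R.dual z)) ≫ _ ◁ _ ≫ ((c z : ℂ)⁻¹ • R.death z) = _
  rw [Linear.smul_comp, Linear.comp_smul, Linear.comp_smul, smul_smul]
  rfl

end RigidityChoice

theorem exists_rescale_isPseudoSpherical {C : Type u} [Category.{v} C] [Abelian C] [Linear ℂ C]
    [MonoidalCategory C] [IsFusionCategory C] (hC : Skeletal C) (R : RigidityChoice C) :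
    ∃ c : Strand C → ℂˣ, (R.rescale c).IsPseudoSpherical := by
  have hs := simpleFamily_single hC
  choose a ha using fun z => end_unit_strictification_eq_smul (R.ptrLeft z (𝟙 _))
  have ha₀ : ∀ z, a z ≠ 0 := fun z h₀ => by
    have h := @SimpleFamily.trLeft_ne_zero _ _ _ _ _ _ _ _ _ hs _ _ _ (R.pairing z)
      (R.pairing (R.dual z)) (hs.id_ne_zero (R.dual z)) (R.doubleDualIso z)
    refine h ?_
    rw [← Category.comp_id (R.doubleDualIso z).inv, ← R.ptrLeft_eq, ha, h₀, zero_smul]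
  choose r hr using fun z => IsAlgClosed.exists_eq_mul_self (a z)
  have hr₀ : ∀ z, r z ≠ 0 := fun z h => ha₀ z (by rw [hr, h, zero_mul])
  refine ⟨fun z => Units.mk0 (r z) (hr₀ z), ?_⟩
  rw [RigidityChoice.isPseudoSpherical_iff]
  intro z
  refine @SimpleFamily.isSpherical_of_trRight_eq_trLeft _ _ _ _ _ _ _ _ _ hs _ _ _
    ((R.rescale _).pairing z) ((R.rescale _).pairing (R.dual z)) _ ?_
  rw [← Category.id_comp ((R.rescale _).doubleDualIso z).hom,
    ← Category.comp_id ((R.rescale _).doubleDualIso z).inv]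
  refine ((R.ptrRight_rescale _ z (𝟙 _)).trans ?_).trans (R.ptrLeft_rescale _ z (𝟙 _)).symm
  rw [R.ptrRight_id, ha, ha, smul_smul, smul_smul, hr z, hr (R.dual z)]
  congr 1
  have h₁ := hr₀ z
  have h₂ := hr₀ (R.dual z)
  simp only [Units.val_mk0]
  field_simp

end Rescaling

section QuadrupleDual

open Strictification

variable {C : Type u} [Category.{v} C] [Abelian C] [MonoidalCategory C]

namespace Strictification

theorem isEqToHom_associator (L M N : Strictification C) : IsEqToHom (α_ L M N).hom :=
  ⟨List.append_assoc L M N, rfl⟩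

theorem isEqToHom_leftUnitor (L : Strictification C) : IsEqToHom (λ_ L).hom :=
  ⟨List.nil_append L, rfl⟩

theorem isEqToHom_rightUnitor (L : Strictification C) : IsEqToHom (ρ_ L).hom :=
  ⟨List.append_nil L, rfl⟩

theorem pairingEq_tensor_unit {L M : Strictification C} (p : ExactPairing L M) :
    PairingEq (@ExactPairing.tensor _ _ _ _ _ _ _ p exactPairingUnit) p :=
  ⟨_, _, isEqToHom_rightUnitor L, isEqToHom_leftUnitor M, tensor_unit_coevaluation L M⟩

theorem pairingEq_unit_tensor {L M : Strictification C} (p : ExactPairing L M) :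
    PairingEq (@ExactPairing.tensor _ _ _ _ _ _ _ exactPairingUnit p) p :=
  ⟨_, _, isEqToHom_leftUnitor L, isEqToHom_rightUnitor M, unit_tensor_coevaluation L M⟩

theorem pairingEq_tensor_assoc {L₁ M₁ L₂ M₂ L₃ M₃ : Strictification C} (p₁ : ExactPairing L₁ M₁)
    (p₂ : ExactPairing L₂ M₂) (p₃ : ExactPairing L₃ M₃) :
    PairingEq (@ExactPairing.tensor _ _ _ _ _ _ _ p₁ (@ExactPairing.tensor _ _ _ _ _ _ _ p₂ p₃))
      (@ExactPairing.tensor _ _ _ _ _ _ _ (@ExactPairing.tensor _ _ _ _ _ _ _ p₁ p₂) p₃) :=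
  ⟨_, _, (isEqToHom_associator L₁ L₂ L₃).inv, isEqToHom_associator M₃ M₂ M₁,
    tensor_assoc_coevaluation L₁ M₁ L₂ M₂ L₃ M₃⟩

end Strictification

namespace RigidityChoice

variable (R : RigidityChoice C)

theorem pairingList_single (x : Strand C) :
    PairingEq (R.pairingList (single x)) (R.pairing x) :=
  pairingEq_tensor_unit (R.pairing x)

theorem pairingList_tensor : ∀ L M : Strictification C,
    PairingEq (R.pairingList (L ⊗ M))
      (@ExactPairing.tensor _ _ _ _ _ _ _ (R.pairingList L) (R.pairingList M))
  | [], M => (pairingEq_unit_tensor (R.pairingList M)).symm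
  | x :: L, M => ((PairingEq.refl (R.pairing x)).tensor (pairingList_tensor L M)).trans
      (pairingEq_tensor_assoc (R.pairing x) (R.pairingList L) (R.pairingList M))

theorem isEqToHom_rightDualTensorIso (L M : Strictification C) :
    IsEqToHom (@rightDualTensorIso _ _ _ L M (R.rightRigid.rightDual L) (R.rightRigid.rightDual M)
      (R.rightRigid.rightDual (L ⊗ M))).hom :=
  (R.pairingList_tensor L M).isEqToHom

theorem isEqToHom_quadrupleDualTensor (L M : Strictification C) :
    IsEqToHom (@quadrupleDualTensor _ _ _ R.rightRigid L M).hom := by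
  let _ := R.rightRigid
  have h : ∀ L M : Strictification C, IsEqToHom (doubleDualTensor L M).hom := fun L M =>
    IsEqToHom.doubleDualComparison (R.isEqToHom_rightDualTensorIso L M)
      (R.isEqToHom_rightDualTensorIso (Mᘁ) (Lᘁ))
  exact (h L M).rightAdjointMate.rightAdjointMate.comp (h _ _)

theorem isEqToHom_quadrupleDualUnit :
    IsEqToHom (@quadrupleDualUnit (Strictification C) _ _ R.rightRigid).hom := by
  let _ := R.rightRigid
  have h₀ : IsEqToHom (dualUnit (C := Strictification C)).hom :=
    (PairingEq.refl (exactPairingUnit (C := Strictification C))).isEqToHom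
  have h : IsEqToHom (doubleDualUnit (Strictification C)).hom :=
    IsEqToHom.doubleDualComparison (p := exactPairingUnit) (q := exactPairingUnit) h₀ h₀
  exact h.rightAdjointMate.rightAdjointMate.comp h

theorem isEqToHom_doubleDualComparison (x : Strand C) :
    IsEqToHom (@doubleDualComparison _ _ _ R.rightRigid _ _ _ (R.pairing x)
      (R.pairing (R.dual x))).hom := by
  let _ := R.rightRigid
  exact IsEqToHom.doubleDualComparison (R.pairingList_single x).isEqToHom
    (R.pairingList_single (R.dual x)).isEqToHom

end RigidityChoice

theorem quadDual_eq_id {C : Type u} [Category.{v} C] [Abelian C] [Linear ℂ C]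
    [MonoidalCategory C] [IsFusionCategory C] (hC : Skeletal C) (R : RigidityChoice C)
    (hR : R.IsPseudoSpherical) :
    ∃ h : R.quadDual = 𝟭 (Strictification C),
      @IsMonoidalQuadrupleDualIso (Strictification C) _ _ R.rightRigid (eqToIso h) := by
  let _ := R.rightRigid
  have hs := simpleFamily_single hC
  let φ : ∀ x : Strand C, single x ≅ ((single x)ᘁ)ᘁ := fun x =>
    R.doubleDualIso x ≪≫ (doubleDualComparison (R.pairing x) (R.pairing (R.dual x))).symm
  have hφ : ∀ x, IsEqToHom (φ x).hom := fun x =>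
    IsEqToHom.comp ⟨congrArg single (R.dual_dual x).symm, rfl⟩ (R.isEqToHom_doubleDualComparison x).inv
  obtain ⟨Φ, hΦ⟩ := hs.exists_natIso (doubleDual (Strictification C)) φ
  have hpivot : ∀ x, pivot Φ (single x) = φ x := fun x => Iso.ext (hΦ x)
  have hsph : ∀ x : Strand C, IsSpherical ((single x)ᘁ : Strictification C) (pivot Φ (single x)) := fun x => by
    rw [hpivot]
    refine (@isSpherical_comparison_iff _ _ _ _ _ _ _ (R.pairing x) (R.pairing (R.dual x)) _).2 ?_
    rw [Iso.trans_assoc, Iso.symm_self_id, Iso.trans_refl]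
    exact R.isPseudoSpherical_iff.1 hR x
  have he := hs.isMonoidalQuadrupleDualIso hsph
  have key : ∀ L : Strictification C, IsEqToHom ((quadrupleDualIso Φ).hom.app L) := by
    intro L
    induction L with
    | nil => exact he.2 ▸ R.isEqToHom_quadrupleDualUnit
    | cons x L ih =>
      have h₁ : IsEqToHom ((quadrupleDualIso Φ).hom.app (single x)) := by
        rw [quadrupleDualIso_hom_app]
        have h₂ := hpivot x
        have h₃ : IsEqToHom (pivot Φ (((single x)ᘁ)ᘁ)).hom := by
          have := hφ (R.dual (R.dual x))
          rw [← hpivot] at this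
          exact this
        rw [h₂]
        exact h₃.inv.comp (hφ x).inv
      have h₄ := he.1 (single x) L
      change IsEqToHom ((quadrupleDualIso Φ).hom.app (single x ⊗ L))
      rw [h₄]
      exact (R.isEqToHom_quadrupleDualTensor (single x) L).comp (h₁.tensorHom ih)
  have h : quadrupleDual (Strictification C) = 𝟭 (Strictification C) := by
    refine CategoryTheory.Functor.ext (fun L => (key L).1) fun L M f => ?_
    have hn := (quadrupleDualIso Φ).hom.naturality f
    obtain ⟨hL, eL⟩ := key L
    obtain ⟨hM, eM⟩ := key M
    rw [eL, eM] at hn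
    rw [← Category.assoc, ← comp_eqToHom_iff]
    exact hn
  have h' : eqToIso h = quadrupleDualIso Φ := by
    refine Iso.ext (NatTrans.ext (funext fun L => ?_))
    obtain ⟨hL, eL⟩ := key L
    rw [eL, eqToIso.hom, eqToHom_app]
  exact ⟨h, h' ▸ he⟩

end QuadrupleDual

theorem theorem3 (C : Type u) [Category.{v} C] [Abelian C] [Linear ℂ C] [MonoidalCategory C]
    [IsFusionCategory C] :
    (Skeletal C →
      Nonempty (RigidityChoice C) ∧
      (∀ R : RigidityChoice C, ∃ c : Strand C → ℂˣ, (R.rescale c).IsPseudoSpherical) ∧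
      (∀ R : RigidityChoice C, R.IsPseudoSpherical →
        ∃ h : R.quadDual = 𝟭 (Strictification C),
          @IsMonoidalQuadrupleDualIso (Strictification C) _ _ R.rightRigid (eqToIso h))) ∧
    (∀ [RightRigidCategory C],
      ∃ e : quadrupleDual C ≅ 𝟭 C, IsMonoidalQuadrupleDualIso e) := by
  refine ⟨fun hC => ⟨nonempty_rigidityChoice hC, exists_rescale_isPseudoSpherical hC,
    quadDual_eq_id hC⟩, ?_⟩
  intro _
  obtain ⟨ι, s, hs⟩ := exists_simpleFamily C
  exact hs.exists_isMonoidalQuadrupleDualIso end_unit_eq_smul
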